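/- For positive integers $d,n$ and a real number $r>0$, let $G_d(n,r)$ be the random geometric graph on vertex set $[n]=\{1,\dots,n\}$ obtained from independent uniform random points $X_1,\dots,X_n$ of $[0,1]^d$ by joining distinct $i,j$ if and only if $\lVert X_i-X_j\rVert\le r$ (Euclidean distance). For $\alpha\in[0,1]$, an $\alpha$-subgraph of a graph $G$ is a spanning subgraph $H\subseteq G$ with $d_H(v)\ge\alpha\, d_G(v)$ for every vertex $v$. For an integer $k\ge 1$, a graph $G$ is $k$-connected if $|V(G)|>k$ and $G-U$ is connected for every $U\subseteq V(G)$ with $|U|<k$; for real $k>0$, $k$-connected means $\lceil k\rceil$-connected. A.a.s. means with probability tending to $1$ as $n\to\infty$. There is an absolute constant $K>0$ such that the following holds. For every $\epsilon\in(0,1/2]$ and every integer $d\ge1$, there are constants $c_1=c_1(d,\epsilon)>0$ and $C_1=C_1(d,\epsilon)>0$, where $C_1=K\epsilon^{-2/d}\sqrt d$, such that for every sequence $r=r(n)$ with $C_1(\log n/n)^{1/d}\le r\le\sqrt d$ for all sufficiently large $n$, a.a.s. every $(1/2+\epsilon)$-subgraph of $G_d(n,r)$ is $(c_1r^dn)$-connected.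 In particular, for every sequence $r=r(n)$ with $r\ge C_1(\log n/n)^{1/d}$ for all sufficiently large $n$, a.a.s. every $(1/2+\epsilon)$-subgraph of $G_d(n,r)$ is connected. -/

import Mathlib

open MeasureTheory Filter Topology

namespace RGG

/-- The unit cube `[0,1]^d` in Euclidean space. -/
def unitCube (d : ℕ) : Set (EuclideanSpace ℝ (Fin d)) :=
  {x | ∀ i, x i ∈ Set.Icc (0 : ℝ) 1}

/-- The uniform distribution on `[0,1]^d`: Lebesgue measure restricted to the cube, which has
volume one. -/
noncomputable def uniformCube (d : ℕ) : Measure (EuclideanSpace ℝ (Fin d)) :=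
  volume.restrict (unitCube d)

/-- The joint law of `n` independent uniform points of `[0,1]^d`. -/
noncomputable def pointsLaw (d n : ℕ) : Measure (Fin n → EuclideanSpace ℝ (Fin d)) :=
  Measure.pi fun _ => uniformCube d

/-- The geometric graph of a labelled family of points: distinct labels are adjacent when their
points are at Euclidean distance at most `r`. The random geometric graph `G_d(n,r)` is
`geomGraph X r` for `X` distributed according to `pointsLaw d n`. -/
def geomGraph {d n : ℕ} (X : Fin n → EuclideanSpace ℝ (Fin d)) (r : ℝ) :
    SimpleGraph (Fin n) where
  Adj i j := i ≠ j ∧ dist (X i) (X j) ≤ r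
  symm := ⟨fun i j h => ⟨h.1.symm, by rw [dist_comm]; exact h.2⟩⟩
  loopless := ⟨fun _ h => h.1 rfl⟩

/-- `H` is an `α`-subgraph of `G`: `H ⊆ G` on the same vertices, and
`d_H(v) ≥ α d_G(v)` for every vertex `v`. -/
def IsAlphaSubgraph {V : Type*} (α : ℝ) (H G : SimpleGraph V) : Prop :=
  H ≤ G ∧ ∀ v, α * ((G.neighborSet v).ncard : ℝ) ≤ ((H.neighborSet v).ncard : ℝ)

/-- `G` is `k`-connected: it has more than `k` vertices, and deleting any fewer than `k` vertices
leaves a connected graph. -/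
def IsKConnected {V : Type*} [Fintype V] (G : SimpleGraph V) (k : ℕ) : Prop :=
  k < Fintype.card V ∧
    ∀ U : Finset V, U.card < k → (G.induce ((U : Set V)ᶜ)).Connected

/-- The radius bound `C (log n / n)^{1/d}`. -/
noncomputable def radiusBound (C : ℝ) (d n : ℕ) : ℝ :=
  C * (Real.log n / n) ^ ((1 : ℝ) / d)

/-- A property of the random geometric graph `G_d(n, r n)` holds asymptotically almost surely: its
probability tends to one as `n → ∞`. -/
def AAS (d : ℕ) (r : ℕ → ℝ) (P : (n : ℕ) → SimpleGraph (Fin n) → Prop) : Prop :=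
  Tendsto (fun n => pointsLaw d n {X | P n (geomGraph X (r n))}) atTop (𝓝 1)

theorem volume_unitCube (d : ℕ) : volume (unitCube d) = 1 := by
  have h := (PiLp.volume_preserving_ofLp (Fin d)).measure_preimage
    (s := Set.univ.pi fun _ : Fin d => Set.Icc (0 : ℝ) 1)
    (MeasurableSet.univ_pi fun _ => measurableSet_Icc).nullMeasurableSet
  have e : unitCube d =
      WithLp.ofLp ⁻¹' (Set.univ.pi fun _ : Fin d => Set.Icc (0 : ℝ) 1) := by
    ext x
    simp only [unitCube, Set.mem_setOf_eq, Set.mem_preimage, Set.mem_pi, Set.mem_univ,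
      true_imp_iff]
  rw [e, h, volume_pi_pi]
  simp

instance instProbUniformCube (d : ℕ) : IsProbabilityMeasure (uniformCube d) :=
  ⟨by rw [uniformCube, Measure.restrict_apply_univ, volume_unitCube]⟩

instance instProbPointsLaw (d n : ℕ) : IsProbabilityMeasure (pointsLaw d n) := by
  unfold pointsLaw
  infer_instance

end RGG

namespace RGG

/-! Write `W = (r / √d) ^ d`, the order, up to factors `c ^ d`, of the volume of an `r`-ball in the
cube. Suppose deleting a set `U` of fewer than `k` vertices disconnects `H` into sides `A` and `B`.
Since `H` keeps more than half of every degree, each vertex of `A` sees clearly more of `A` than of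
`B` within distance `r`, and conversely. Let `g x` be the number of `A`-points minus the number of
`B`-points within `r` of a location `x`. At sample points outside `U`, `|g|` is at least `3/4 * ε *
n * W`, while a move by a small multiple of `r` changes `g` by at most `ε/8 * n * W`
(`abs_ballCount_sub_le`).

On a segment from an `A`-point to a `B`-point, `g` passes through a small value, so there is a
balanced location `x₀`. Near it both sides fill a volume of order `W`
(`le_volume_cellHull_of_balanced`). The balanced locations near `x₀` contain no sample points except
those of `U`, so their volume is tiny (`volume_cellHull_balanced_le`). But every segment from the
`A`-region to the `B`-region crosses them, and `min_volume_le_of_segments_meet` forces a large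
volume: a contradiction (`eq_empty`).

All the randomness is in `EvenlySpread`. Subgraphs and cuts are adversarial, so it must hold for
every set `T` in a ball at once; rounding `T` to grid cells leaves boundedly many sets per ball, and
a Chernoff bound with a union bound (`measureReal_not_evenlySpread_le_div`) gives failure
probability `O(1/n)`. -/

/-! ### Volumes of balls and annuli, with explicit dependence on the dimension. -/

theorem rpow_self_mul_exp_neg_le_Gamma {x : ℝ} (hx : 0 ≤ x) :
    x ^ x * Real.exp (-x) ≤ Real.Gamma (x + 1) := by
  rw [Real.Gamma_eq_integral (by linarith)]
  have hint := Real.GammaIntegral_convergent (s := x + 1) (by linarith)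
  have hsub : Set.Ioi x ⊆ Set.Ioi 0 := Set.Ioi_subset_Ioi hx
  -- Only the part `t > x` of the Gamma integral is kept, where `t ^ x ≥ x ^ x`.
  calc x ^ x * Real.exp (-x) = ∫ t in Set.Ioi x, Real.exp (-t) * x ^ x := by
        rw [integral_mul_const, integral_exp_neg_Ioi, mul_comm]
    _ ≤ ∫ t in Set.Ioi x, Real.exp (-t) * t ^ (x + 1 - 1) := by
        refine setIntegral_mono_on ?_ (hint.mono_set hsub) measurableSet_Ioi ?_
        · exact (integrableOn_exp_neg_Ioi x).mul_const _
        · intro t ht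
          rw [add_sub_cancel_right]
          exact mul_le_mul_of_nonneg_left (Real.rpow_le_rpow hx (le_of_lt ht) hx)
            (Real.exp_pos _).le
    _ ≤ ∫ t in Set.Ioi 0, Real.exp (-t) * t ^ (x + 1 - 1) := by
        refine setIntegral_mono_set hint ?_ hsub.eventuallyLE
        refine (ae_restrict_iff' measurableSet_Ioi).2 (Eventually.of_forall fun t ht => ?_)
        exact mul_nonneg (Real.exp_pos _).le (Real.rpow_nonneg (le_of_lt ht) _)

/-- Stirling's bound for Gamma gives the constant `√(2πe) < 5`. Losing only a factor `5 ^ d` against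
`(r / √d) ^ d` is what allows `C₁` to be an absolute constant times `ε ^ (-2/d) * √d`. -/
theorem volumeReal_closedBall_le {d : ℕ} (hd : 1 ≤ d) (x : EuclideanSpace ℝ (Fin d)) {r : ℝ}
    (hr : 0 ≤ r) : volume.real (Metric.closedBall x r) ≤ (5 * (r / √d)) ^ d := by
  have : Nonempty (Fin d) := ⟨⟨0, hd⟩⟩
  have hd0 : (0 : ℝ) < d := by exact_mod_cast hd
  have hG : 0 < Real.Gamma ((d : ℝ) / 2 + 1) := Real.Gamma_pos_of_pos (by positivity)
  rw [measureReal_def, EuclideanSpace.volume_closedBall, ENNReal.toReal_mul, ENNReal.toReal_pow,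
    ENNReal.toReal_ofReal hr, Fintype.card_fin, ENNReal.toReal_ofReal (by positivity),
    mul_pow, div_pow, mul_comm (5 ^ d) _, div_mul_eq_mul_div, mul_div_assoc]
  refine mul_le_mul_of_nonneg_left ?_ (by positivity)
  rw [div_le_div_iff₀ hG (by positivity), ← mul_pow]
  refine le_trans ?_ (mul_le_mul_of_nonneg_left
    (rpow_self_mul_exp_neg_le_Gamma (x := (d : ℝ) / 2) (by positivity)) (by positivity))
  have e1 : ((d : ℝ) / 2) ^ ((d : ℝ) / 2) = (√((d : ℝ) / 2)) ^ d := by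
    rw [Real.sqrt_eq_rpow, ← Real.rpow_mul_natCast (by positivity)]
    congr 1; ring
  have e2 : Real.exp (-((d : ℝ) / 2)) = Real.exp (-(1 / 2)) ^ d := by
    rw [← Real.exp_nat_mul]; congr 1; ring
  rw [e1, e2, ← mul_pow, ← mul_pow]
  refine pow_le_pow_left₀ (by positivity) ?_ d
  have hexp : Real.exp (-(1 / 2)) = √(Real.exp (-1)) := by
    rw [Real.sqrt_eq_rpow, ← Real.exp_mul]; congr 1; norm_num
  have h5 : (5 : ℝ) = √25 := by
    rw [show (25 : ℝ) = 5 ^ 2 by norm_num, Real.sqrt_sq (by norm_num)]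
  rw [hexp, h5, ← Real.sqrt_mul (by positivity), ← Real.sqrt_mul (by positivity),
    ← Real.sqrt_mul (by positivity)]
  -- What remains amounts to `π ≤ 25 / (2e)`.
  refine Real.sqrt_le_sqrt ?_
  have hpi := Real.pi_lt_d2
  have he : (0.36 : ℝ) ≤ Real.exp (-1) := by
    have := Real.exp_neg_one_gt_d9; linarith
  nlinarith

theorem measurableSet_unitCube (d : ℕ) : MeasurableSet (unitCube d) := by
  have : unitCube d = ⋂ i, (fun x : EuclideanSpace ℝ (Fin d) => x i) ⁻¹' Set.Icc (0 : ℝ) 1 := by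
    ext x; simp [unitCube]
  rw [this]
  exact MeasurableSet.iInter fun i => (by fun_prop : Measurable
    (fun x : EuclideanSpace ℝ (Fin d) => x i)) measurableSet_Icc

theorem convex_unitCube (d : ℕ) : Convex ℝ (unitCube d) := by
  intro x hx y hy a b ha hb hab i
  have := (convex_Icc (0 : ℝ) 1) (hx i) (hy i) ha hb hab
  simpa using this

theorem dist_le_sqrt_of_forall_abs_le {d : ℕ} {x y : EuclideanSpace ℝ (Fin d)} {c : ℝ}
    (hc : 0 ≤ c) (h : ∀ i, |x i - y i| ≤ c) : dist x y ≤ √d * c := by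
  rw [EuclideanSpace.dist_eq]
  have : √d * c = √(∑ _i : Fin d, c ^ 2) := by
    rw [Finset.sum_const, Finset.card_univ, Fintype.card_fin, nsmul_eq_mul,
      Real.sqrt_mul (Nat.cast_nonneg d), Real.sqrt_sq hc]
  rw [this]
  refine Real.sqrt_le_sqrt (Finset.sum_le_sum fun i _ => ?_)
  rw [Real.dist_eq]
  exact pow_le_pow_left₀ (abs_nonneg _) (h i) 2

theorem dist_le_sqrt_of_mem_unitCube {d : ℕ} {x y : EuclideanSpace ℝ (Fin d)}
    (hx : x ∈ unitCube d) (hy : y ∈ unitCube d) : dist x y ≤ √d := by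
  have := dist_le_sqrt_of_forall_abs_le (x := x) (y := y) zero_le_one fun i => by
    have h1 := hx i; have h2 := hy i
    rw [abs_le]; constructor <;> linarith [h1.1, h1.2, h2.1, h2.2]
  simpa using this

/-- A ball centred in the cube meets it in a set containing a scaled copy of the cube. -/
theorem le_volumeReal_closedBall_inter_unitCube {d : ℕ} (hd : 1 ≤ d)
    {x : EuclideanSpace ℝ (Fin d)} (hx : x ∈ unitCube d) {r : ℝ} (hr : 0 ≤ r) (hr' : r ≤ √d) :
    (r / √d) ^ d ≤ volume.real (Metric.closedBall x r ∩ unitCube d) := by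
  have hd0 : 0 < √(d : ℝ) := Real.sqrt_pos.2 (by exact_mod_cast hd)
  set t := r / √d with ht
  have ht0 : 0 ≤ t := by positivity
  have ht1 : t ≤ 1 := (div_le_one hd0).2 hr'
  -- The cube has diameter at most `√d`, so shrinking it towards `x` by `t = r / √d` keeps it within
  -- `r` of `x`, and inside the cube by convexity.
  have hsub : AffineMap.homothety x t '' unitCube d ⊆ Metric.closedBall x r ∩ unitCube d := by
    rintro _ ⟨y, hy, rfl⟩
    refine ⟨?_, ?_⟩
    · rw [Metric.mem_closedBall, dist_homothety_center, Real.norm_eq_abs, abs_of_nonneg ht0]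
      calc t * dist x y ≤ t * √d := by
            gcongr; exact dist_le_sqrt_of_mem_unitCube hx hy
        _ = r := by rw [ht]; field_simp
    · have := (convex_unitCube d) hx hy (sub_nonneg.2 ht1) ht0 (by ring)
      convert this using 1
      rw [AffineMap.homothety_apply, vsub_eq_sub, vadd_eq_add]
      module
  have h := measureReal_mono (μ := volume) hsub
    (ne_top_of_le_ne_top measure_closedBall_lt_top.ne (measure_mono Set.inter_subset_left))
  refine le_trans (le_of_eq ?_) h
  rw [measureReal_def, Measure.addHaar_image_homothety, volume_unitCube]
  simp [ENNReal.toReal_ofReal, abs_of_nonneg, ht0]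

theorem volumeReal_annulus_le {d : ℕ} (hd : 1 ≤ d) (x : EuclideanSpace ℝ (Fin d)) {r t : ℝ}
    (hr : 0 ≤ r) (ht0 : 0 ≤ t) (ht1 : t ≤ 1) :
    volume.real {y | r * (1 - t) ≤ dist y x ∧ dist y x ≤ r * (1 + t)} ≤
      2 * t * 20 ^ d * (r / √d) ^ d := by
  have : Nonempty (Fin d) := ⟨⟨0, hd⟩⟩
  have hset : {y | r * (1 - t) ≤ dist y x ∧ dist y x ≤ r * (1 + t)} =
      Metric.closedBall x (r * (1 + t)) \ Metric.ball x (r * (1 - t)) := by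
    ext y; simp [and_comm]
  have hs : Metric.ball x (r * (1 - t)) ⊆ Metric.closedBall x (r * (1 + t)) :=
    Metric.ball_subset_closedBall.trans (Metric.closedBall_subset_closedBall
      (mul_le_mul_of_nonneg_left (by linarith) hr))
  rw [hset, measureReal_sdiff hs measurableSet_ball measure_closedBall_lt_top.ne]
  have e1 : volume.real (Metric.closedBall x (r * (1 + t))) =
      (1 + t) ^ d * volume.real (Metric.closedBall x r) := by
    simp only [measureReal_def, EuclideanSpace.volume_closedBall, ENNReal.toReal_mul,
      ENNReal.toReal_pow, Fintype.card_fin]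
    rw [ENNReal.toReal_ofReal hr, ENNReal.toReal_ofReal (by positivity), mul_pow]
    ring
  have e2 : volume.real (Metric.ball x (r * (1 - t))) =
      (1 - t) ^ d * volume.real (Metric.closedBall x r) := by
    simp only [measureReal_def, EuclideanSpace.volume_closedBall, EuclideanSpace.volume_ball,
      ENNReal.toReal_mul, ENNReal.toReal_pow, Fintype.card_fin]
    rw [ENNReal.toReal_ofReal hr, ENNReal.toReal_ofReal
      (mul_nonneg hr (by linarith)), mul_pow]
    ring
  rw [e1, e2, ← sub_mul]
  have hv := volumeReal_closedBall_le hd x hr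
  rw [mul_pow] at hv
  have hp : (1 + t) ^ d - (1 - t) ^ d ≤ 2 * t * 4 ^ d := by
    have h1 := abs_pow_sub_pow_le (1 + t) (1 - t) d
    have h2 : max |1 + t| |1 - t| ≤ 2 := by
      rw [max_le_iff, abs_le, abs_le]; constructor <;> constructor <;> linarith
    have h3 : |1 + t - (1 - t)| = 2 * t := by
      rw [abs_of_nonneg] <;> linarith
    -- The factor `d` from differentiating the power is absorbed into an exponential, giving `4 ^
    -- d`.
    have hd2 : (d : ℝ) ≤ 2 ^ d := by exact_mod_cast Nat.lt_two_pow_self.le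
    rw [h3] at h1
    calc (1 + t) ^ d - (1 - t) ^ d ≤ _ := (le_abs_self _).trans h1
      _ ≤ 2 * t * 2 ^ d * 2 ^ d := by
        gcongr
        exact (pow_le_pow_left₀ (le_max_of_le_left (abs_nonneg _)) h2 _).trans
          (pow_le_pow_right₀ one_le_two (Nat.sub_le d 1))
      _ = 2 * t * 4 ^ d := by
        rw [show (4 : ℝ) = 2 * 2 by norm_num, mul_pow]; ring
  calc _ ≤ 2 * t * 4 ^ d * (5 ^ d * (r / √d) ^ d) :=
        mul_le_mul hp hv measureReal_nonneg (by positivity)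
    _ = _ := by rw [show (20 : ℝ) = 4 * 5 by norm_num, mul_pow]; ring

/-! ### An isoperimetric inequality by averaging over segments. -/

theorem volume_preimage_smul_add_le {d : ℕ} {M : Set (EuclideanSpace ℝ (Fin d))} {s : ℝ}
    (hs : 1 / 2 ≤ s) (w : EuclideanSpace ℝ (Fin d)) :
    volume ((fun x => s • x + w) ⁻¹' M) ≤ 2 ^ d * volume M := by
  have e : (fun x : EuclideanSpace ℝ (Fin d) => s • x + w) ⁻¹' M =
      (fun x => s • x) ⁻¹' ((fun x => x + w) ⁻¹' M) := rfl
  rw [e, Measure.addHaar_preimage_smul _ (by linarith : s ≠ 0), measure_preimage_add_right,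
    finrank_euclideanSpace_fin]
  gcongr
  rw [show (2 : ENNReal) ^ d = ENNReal.ofReal (2 ^ d) by
    rw [ENNReal.ofReal_pow (by norm_num)]; norm_num]
  refine ENNReal.ofReal_le_ofReal ?_
  have hs0 : 0 < s := by linarith
  rw [abs_of_nonneg (by positivity), ← inv_pow]
  refine pow_le_pow_left₀ (by positivity) ?_ d
  rw [inv_le_comm₀ hs0 (by norm_num)]; linarith

/-- If every segment from `A` to `B`, subdivided into `m` steps, meets `M`, then `M` is large. -/
theorem min_volume_le_of_segments_meet {d m : ℕ} {A B M : Set (EuclideanSpace ℝ (Fin d))}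
    (hA : MeasurableSet A) (hB : MeasurableSet B) (hM : MeasurableSet M)
    (hA' : volume A ≠ ⊤) (hB' : volume B ≠ ⊤)
    (h : ∀ x ∈ A, ∀ y ∈ B, ∃ i ∈ Finset.range (m + 1),
      (1 - (i : ℝ) / m) • x + ((i : ℝ) / m) • y ∈ M) :
    min (volume A) (volume B) ≤ (m + 1) * (2 ^ d * volume M) := by
  set P : ℕ → Set (EuclideanSpace ℝ (Fin d) × EuclideanSpace ℝ (Fin d)) := fun i =>
    (A ×ˢ B) ∩ (fun p => (1 - (i : ℝ) / m) • p.1 + ((i : ℝ) / m) • p.2) ⁻¹' M with hP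
  have hPm : ∀ i, MeasurableSet (P i) := fun i =>
    (hA.prod hB).inter ((by fun_prop : Measurable
      (fun p : EuclideanSpace ℝ (Fin d) × EuclideanSpace ℝ (Fin d) =>
        (1 - (i : ℝ) / m) • p.1 + ((i : ℝ) / m) • p.2)) hM)
  -- One of the two coefficients is at least `1/2`. Freezing the other endpoint, the intermediate
  -- point is an affine image with that scale, so the preimage of `M` grows by at most `2 ^ d`.
  have hle : ∀ i, volume (P i) ≤ max (volume A) (volume B) * (2 ^ d * volume M) := by
    intro i
    rcases le_total ((i : ℝ) / m) (1 / 2) with hi | hi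
    · rw [Measure.volume_eq_prod, Measure.prod_apply_symm (hPm i)]
      calc _ ≤ ∫⁻ y in B, 2 ^ d * volume M := by
            rw [← lintegral_indicator hB]
            refine lintegral_mono fun y => ?_
            by_cases hy : y ∈ B
            · rw [Set.indicator_of_mem hy]
              refine le_trans (measure_mono ?_) (volume_preimage_smul_add_le
                (s := 1 - (i : ℝ) / m) (by linarith) (((i : ℝ) / m) • y))
              intro x hx; exact hx.2
            · rw [Set.indicator_of_notMem hy]
              refine (measure_mono_null (t := ∅) ?_ measure_empty).le
              intro x hx; exact hy hx.1.2
        _ ≤ _ := by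
            rw [setLIntegral_const, mul_comm]; gcongr; exact le_max_right _ _
    · rw [Measure.volume_eq_prod, Measure.prod_apply (hPm i)]
      calc _ ≤ ∫⁻ y in A, 2 ^ d * volume M := by
            rw [← lintegral_indicator hA]
            refine lintegral_mono fun y => ?_
            by_cases hy : y ∈ A
            · rw [Set.indicator_of_mem hy]
              refine le_trans (measure_mono ?_) (volume_preimage_smul_add_le
                (s := (i : ℝ) / m) hi ((1 - (i : ℝ) / m) • y))
              intro x hx
              have := hx.2
              simp only [Set.mem_preimage] at this ⊢
              rwa [add_comm]
            · rw [Set.indicator_of_notMem hy]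
              refine (measure_mono_null (t := ∅) ?_ measure_empty).le
              intro x hx; exact hy hx.1.1
        _ ≤ _ := by
            rw [setLIntegral_const, mul_comm]; gcongr; exact le_max_left _ _
  have hcov : A ×ˢ B ⊆ ⋃ i ∈ Finset.range (m + 1), P i := by
    rintro ⟨x, y⟩ ⟨hx, hy⟩
    obtain ⟨i, hi, hi'⟩ := h x hx y hy
    exact Set.mem_biUnion hi ⟨⟨hx, hy⟩, hi'⟩
  have hprod : volume A * volume B ≤
      max (volume A) (volume B) * ((m + 1) * (2 ^ d * volume M)) := by
    calc volume A * volume B = volume (A ×ˢ B) := by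
          rw [Measure.volume_eq_prod, Measure.prod_prod]
      _ ≤ ∑ i ∈ Finset.range (m + 1), volume (P i) :=
          (measure_mono hcov).trans (measure_biUnion_finset_le _ _)
      _ ≤ ∑ _i ∈ Finset.range (m + 1), max (volume A) (volume B) * (2 ^ d * volume M) :=
          Finset.sum_le_sum fun i _ => hle i
      _ = _ := by
          rw [Finset.sum_const, Finset.card_range, nsmul_eq_mul]; push_cast; ring
  -- The product of the two volumes is max times min, so the max cancels.
  rw [← max_mul_min (volume A) (volume B)] at hprod
  by_cases h0 : max (volume A) (volume B) = 0
  · have : min (volume A) (volume B) ≤ max (volume A) (volume B) := min_le_max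
    rw [h0] at this
    exact this.trans zero_le
  · exact (ENNReal.mul_le_mul_iff_right h0 (max_lt hA'.lt_top hB'.lt_top).ne).1 hprod

/-! ### Chernoff bounds for the number of sample points in a set. -/

section Chernoff

variable {E : Type*}

theorem ncard_setOf_mem_eq_sum_indicator {n : ℕ} (X : Fin n → E) (T : Set E) :
    (({i | X i ∈ T} : Set (Fin n)).ncard : ℝ) = ∑ i, T.indicator (fun _ => (1 : ℝ)) (X i) := by
  classical
  rw [Set.ncard_eq_toFinset_card']
  simp [Set.indicator_apply]

theorem exp_mul_indicator (T : Set E) (t : ℝ) (x : E) :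
    Real.exp (t * T.indicator (fun _ => (1 : ℝ)) x) =
      1 + T.indicator (fun _ => Real.exp t - 1) x := by
  by_cases hx : x ∈ T <;> simp [hx]

variable [MeasurableSpace E]

theorem integrable_exp_mul_indicator (μ : Measure E) [IsProbabilityMeasure μ] {T : Set E}
    (hT : MeasurableSet T) (t : ℝ) :
    Integrable (fun x => Real.exp (t * T.indicator (fun _ => (1 : ℝ)) x)) μ := by
  simp only [exp_mul_indicator]
  exact (integrable_const 1).add ((integrable_const _).indicator hT)

/-- The binomial generating function is `(1 + μ(T)(e^t - 1))^n`, and `1 + x ≤ e^x`. The sign of `t`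
is free, so both tails are served. -/
theorem mgf_ncard_le (μ : Measure E) [IsProbabilityMeasure μ] {T : Set E}
    (hT : MeasurableSet T) (n : ℕ) (t : ℝ) :
    Integrable (fun X : Fin n → E => Real.exp (t * (({i | X i ∈ T} : Set (Fin n)).ncard : ℝ)))
        (Measure.pi fun _ => μ) ∧
      ProbabilityTheory.mgf (fun X : Fin n → E => (({i | X i ∈ T} : Set (Fin n)).ncard : ℝ))
        (Measure.pi fun _ => μ) t ≤ Real.exp (n * μ.real T * (Real.exp t - 1)) := by
  have hfun : (fun X : Fin n → E => Real.exp (t * (({i | X i ∈ T} : Set (Fin n)).ncard : ℝ))) =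
      fun X => ∏ i, Real.exp (t * T.indicator (fun _ => (1 : ℝ)) (X i)) := by
    funext X
    rw [ncard_setOf_mem_eq_sum_indicator, Finset.mul_sum, Real.exp_sum]
  refine ⟨?_, ?_⟩
  · rw [hfun]
    exact Integrable.fintype_prod (f := fun _ x => Real.exp (t * T.indicator (fun _ => (1 : ℝ)) x))
      fun _ => integrable_exp_mul_indicator μ hT t
  · unfold ProbabilityTheory.mgf
    rw [hfun, integral_fintype_prod_eq_pow
      (fun x => Real.exp (t * T.indicator (fun _ => (1 : ℝ)) x)), Fintype.card_fin, mul_assoc,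
      Real.exp_nat_mul]
    refine pow_le_pow_left₀ (integral_nonneg fun _ => (Real.exp_pos _).le) ?_ n
    simp only [exp_mul_indicator]
    rw [integral_add (integrable_const 1) ((integrable_const _).indicator hT),
      integral_indicator_const _ hT]
    simp only [integral_const, probReal_univ, smul_eq_mul, one_mul]
    rw [add_comm]
    exact Real.add_one_le_exp _

/-- Concentration of the number of sample points in `T`, for `T` of measure at most `p`. -/
theorem measureReal_ncard_deviation_le (μ : Measure E) [IsProbabilityMeasure μ] {T : Set E}
    (hT : MeasurableSet T) (n : ℕ) {p a : ℝ} (hp : 0 < p) (ha : 0 ≤ a) (hap : a ≤ 2 * p)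
    (hTp : μ.real T ≤ p) :
    (Measure.pi fun _ : Fin n => μ).real
        {X | n * a < |(({i | X i ∈ T} : Set (Fin n)).ncard : ℝ) - n * μ.real T|} ≤
      2 * Real.exp (-(n * a ^ 2 / (4 * p))) := by
  -- This minimises the exponent `n p l² - l n a`; the hypothesis on `a` makes `l ≤ 1`, so that `e^s
  -- - 1 - s ≤ s²` applies at `s = ±l`.
  set l := a / (2 * p) with hl
  have hl0 : 0 ≤ l := by positivity
  have hl1 : l ≤ 1 := (div_le_one (by positivity)).2 hap
  have key : ∀ s : ℝ, |s| = l → n * μ.real T * (Real.exp s - 1) - s * (n * μ.real T) - l * (n * a)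
      ≤ -(n * a ^ 2 / (4 * p)) := by
    intro s hs
    have h1 := (abs_le.1 (Real.abs_exp_sub_one_sub_id_le (x := s) (hs ▸ hl1))).2
    rw [← sq_abs, hs] at h1
    have h2 : n * μ.real T * (Real.exp s - 1 - s) ≤ n * p * l ^ 2 :=
      (mul_le_mul_of_nonneg_left h1 (by positivity)).trans (by gcongr)
    have h3 : n * p * l ^ 2 - l * (n * a) = -(n * a ^ 2 / (4 * p)) := by
      rw [hl]; field_simp; ring
    rw [← h3]; linarith
  have hup : (Measure.pi fun _ : Fin n => μ).real
      {X | n * μ.real T + n * a ≤ (({i | X i ∈ T} : Set (Fin n)).ncard : ℝ)} ≤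
      Real.exp (-(n * a ^ 2 / (4 * p))) := by
    refine (ProbabilityTheory.measure_ge_le_exp_mul_mgf _ hl0 (mgf_ncard_le μ hT n l).1).trans ?_
    refine (mul_le_mul_of_nonneg_left (mgf_ncard_le μ hT n l).2 (Real.exp_pos _).le).trans ?_
    rw [← Real.exp_add]
    refine Real.exp_le_exp.2 (le_trans (le_of_eq ?_) (key l (abs_of_nonneg hl0)))
    ring
  have hlo : (Measure.pi fun _ : Fin n => μ).real
      {X | (({i | X i ∈ T} : Set (Fin n)).ncard : ℝ) ≤ n * μ.real T - n * a} ≤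
      Real.exp (-(n * a ^ 2 / (4 * p))) := by
    refine (ProbabilityTheory.measure_le_le_exp_mul_mgf _ (neg_nonpos.2 hl0)
      (mgf_ncard_le μ hT n (-l)).1).trans ?_
    refine (mul_le_mul_of_nonneg_left (mgf_ncard_le μ hT n (-l)).2 (Real.exp_pos _).le).trans ?_
    rw [← Real.exp_add]
    refine Real.exp_le_exp.2 (le_trans (le_of_eq ?_) (key (-l) (by rw [abs_neg, abs_of_nonneg hl0])))
    ring
  have hsub : {X : Fin n → E | n * a < |(({i | X i ∈ T} : Set (Fin n)).ncard : ℝ) - n * μ.real T|} ⊆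
      {X | n * μ.real T + n * a ≤ (({i | X i ∈ T} : Set (Fin n)).ncard : ℝ)} ∪
      {X | (({i | X i ∈ T} : Set (Fin n)).ncard : ℝ) ≤ n * μ.real T - n * a} := by
    intro X hX
    simp only [Set.mem_union, Set.mem_ofPred_eq] at hX ⊢
    rcases lt_abs.1 hX with h | h
    · left; linarith
    · right; linarith
  have := (measureReal_mono (μ := Measure.pi fun _ : Fin n => μ) hsub).trans (measureReal_union_le _ _)
  linarith

end Chernoff

/-! ### Grid cells and evenly spread configurations. -/

/-- The index of the grid cell of side `1 / N` containing `x`. -/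
noncomputable def cellIndex {d : ℕ} (N : ℕ) (x : EuclideanSpace ℝ (Fin d)) : Fin d → ℤ :=
  fun i => ⌊(N : ℝ) * x i⌋

/-- The part of the unit cube covered by the grid cells that meet `T` inside the cube. -/
def cellHull {d : ℕ} (N : ℕ) (T : Set (EuclideanSpace ℝ (Fin d))) :
    Set (EuclideanSpace ℝ (Fin d)) :=
  {y | y ∈ unitCube d ∧ ∃ x ∈ T, x ∈ unitCube d ∧ cellIndex N x = cellIndex N y}

section Cells

variable {d N : ℕ} {T : Set (EuclideanSpace ℝ (Fin d))}

theorem measurable_cellIndex (d N : ℕ) :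
    Measurable (cellIndex N : EuclideanSpace ℝ (Fin d) → Fin d → ℤ) := by
  refine measurable_pi_lambda _ fun i => Int.measurable_floor.comp ?_
  fun_prop

theorem measurableSet_cellHull : MeasurableSet (cellHull N T) := by
  -- `T` is arbitrary, but its hull is the preimage of a subset of a countable type, hence
  -- measurable.
  have : cellHull N T = unitCube d ∩ cellIndex N ⁻¹' (cellIndex N '' (T ∩ unitCube d)) := by
    ext y
    simp only [cellHull, Set.mem_ofPred_eq, Set.mem_inter_iff, Set.mem_preimage, Set.mem_image,
      and_assoc]
  rw [this]
  exact (measurableSet_unitCube d).inter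
    (measurable_cellIndex d N (Set.to_countable _).measurableSet)

theorem cellHull_subset_unitCube : cellHull N T ⊆ unitCube d := fun _ h => h.1

theorem inter_subset_cellHull : T ∩ unitCube d ⊆ cellHull N T :=
  fun x hx => ⟨hx.2, x, hx.1, hx.2, rfl⟩

theorem volume_cellHull_ne_top : volume (cellHull N T) ≠ ⊤ :=
  ne_top_of_le_ne_top (by rw [volume_unitCube]; simp) (measure_mono cellHull_subset_unitCube)

theorem dist_le_of_cellIndex_eq (hN : 0 < N) {x y : EuclideanSpace ℝ (Fin d)}
    (h : cellIndex N x = cellIndex N y) : dist x y ≤ √d / N := by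
  have hN' : (0 : ℝ) < N := by exact_mod_cast hN
  rw [div_eq_mul_inv]
  refine dist_le_sqrt_of_forall_abs_le (by positivity) fun i => ?_
  have := Int.abs_sub_lt_one_of_floor_eq_floor (congrFun h i)
  rw [← mul_sub, abs_mul, abs_of_pos hN'] at this
  rw [← one_div, le_div_iff₀ hN']
  linarith

end Cells

/-- Every union of grid cells lying in a ball of radius comparable with `r` contains the expected
number of points `X i`, with an error of at most `n * a`. -/
def EvenlySpread {d n : ℕ} (X : Fin n → EuclideanSpace ℝ (Fin d)) (N : ℕ) (r a : ℝ) : Prop :=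
  ∀ x ∈ unitCube d, ∀ T ⊆ Metric.closedBall x (2 * r),
    |(({i | X i ∈ cellHull N T} : Set (Fin n)).ncard : ℝ) - n * volume.real (cellHull N T)| ≤ n * a

/-- The number of points with labels in `S` at distance at most `r` from `x`. -/
noncomputable def ballCount {d n : ℕ} (X : Fin n → EuclideanSpace ℝ (Fin d)) (r : ℝ)
    (S : Set (Fin n)) (x : EuclideanSpace ℝ (Fin d)) : ℝ :=
  (({i | i ∈ S ∧ dist (X i) x ≤ r} : Set (Fin n)).ncard : ℝ)

/-- The mesh of the grid, relative to the radius. -/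
noncomputable def meshRatio (d : ℕ) (ε : ℝ) : ℝ := ε / (64 * 20 ^ d)

/-- The admissible discrepancy, relative to `(r / √d) ^ d`. -/
noncomputable def discRatio (d : ℕ) (ε : ℝ) : ℝ := meshRatio d ε / (200 * 2 ^ d)

/-! ### The deterministic core: a majority split of evenly spread points is trivial. -/

/-- Evenly spread points, up to a small set `U` of labels, split into `A` and `B`
in such a way that each point sees, within distance `r`, a majority of its own side. -/
structure IsMajoritySplit {d n : ℕ} (ε r : ℝ) (N : ℕ) (X : Fin n → EuclideanSpace ℝ (Fin d))
    (A B U : Set (Fin n)) : Prop where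
  one_le_dim : 1 ≤ d
  card_pos : 0 < n
  eps_pos : 0 < ε
  eps_le : ε ≤ 1 / 2
  radius_pos : 0 < r
  radius_le : r ≤ √d
  grid_pos : 0 < N
  mesh_le : √d / N ≤ meshRatio d ε * r
  mem_cube : ∀ i, X i ∈ unitCube d
  spread : EvenlySpread X N r (discRatio d ε * (r / √d) ^ d)
  cover : ∀ i, i ∈ A ∨ i ∈ B ∨ i ∈ U
  disj : Disjoint A B
  card_le : (U.ncard : ℝ) ≤ n * (discRatio d ε * (r / √d) ^ d)
  majority_left : ∀ u ∈ A, 2 * ε * ballCount X r Set.univ (X u) - 2 * U.ncard ≤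
    ballCount X r A (X u) - ballCount X r B (X u)
  majority_right : ∀ u ∈ B, 2 * ε * ballCount X r Set.univ (X u) - 2 * U.ncard ≤
    ballCount X r B (X u) - ballCount X r A (X u)

/-- A discrete intermediate value theorem: the first index with `f ≤ 0` works, its predecessor being
positive. -/
theorem exists_abs_le_of_sign_change {f : ℕ → ℝ} {m : ℕ} {s : ℝ} (h0 : 0 < f 0) (hm : f m < 0)
    (h : ∀ i < m, |f i - f (i + 1)| ≤ s) : ∃ i ∈ Finset.range (m + 1), |f i| ≤ s := by
  classical
  have hex : ∃ i, f i ≤ 0 := ⟨m, hm.le⟩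
  have hle : Nat.find hex ≤ m := Nat.find_min' hex hm.le
  have hf := Nat.find_spec hex
  refine ⟨Nat.find hex, Finset.mem_range.2 (Nat.lt_succ_of_le hle), ?_⟩
  obtain ⟨k, hk⟩ : ∃ k, Nat.find hex = k + 1 := by
    refine Nat.exists_eq_succ_of_ne_zero fun h => ?_
    rw [h] at hf; linarith
  have hk' := Nat.find_min hex (m := k) (by omega)
  rw [hk] at hf ⊢
  have := (abs_le.1 (h k (by omega))).2
  rw [abs_le]; constructor <;> linarith

namespace IsMajoritySplit

section

variable {d n N : ℕ} {ε r : ℝ} {X : Fin n → EuclideanSpace ℝ (Fin d)} {A B U : Set (Fin n)}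

theorem symm (h : IsMajoritySplit ε r N X A B U) : IsMajoritySplit ε r N X B A U where
  one_le_dim := h.one_le_dim
  card_pos := h.card_pos
  eps_pos := h.eps_pos
  eps_le := h.eps_le
  radius_pos := h.radius_pos
  radius_le := h.radius_le
  grid_pos := h.grid_pos
  mesh_le := h.mesh_le
  mem_cube := h.mem_cube
  spread := h.spread
  cover := fun i => by rcases h.cover i with h | h | h <;> simp [h]
  disj := h.disj.symm
  card_le := h.card_le
  majority_left := h.majority_right
  majority_right := h.majority_left

theorem cellVolume_pos (h : IsMajoritySplit ε r N X A B U) : 0 < n * (r / √d) ^ d := by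
  have h1 := h.radius_pos
  have h2 : 0 < √(d : ℝ) := Real.sqrt_pos.2 (by exact_mod_cast h.one_le_dim)
  have h3 : (0 : ℝ) < n := by exact_mod_cast h.card_pos
  positivity

theorem meshRatio_pos (h : IsMajoritySplit ε r N X A B U) : 0 < meshRatio d ε := by
  have := h.eps_pos
  unfold meshRatio; positivity

theorem meshRatio_mul (d : ℕ) (ε : ℝ) : meshRatio d ε * 20 ^ d = ε / 64 := by
  unfold meshRatio; field_simp

theorem dim_mul_meshRatio_le (h : IsMajoritySplit ε r N X A B U) :
    (d : ℝ) * meshRatio d ε ≤ 1 / 128 := by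
  have hd2 : (d : ℝ) ≤ 20 ^ d := by exact_mod_cast (Nat.lt_pow_self (by norm_num)).le
  have := mul_le_mul_of_nonneg_right hd2 h.meshRatio_pos.le
  have h2 := meshRatio_mul d ε
  have := h.eps_le
  linarith

theorem meshRatio_le (h : IsMajoritySplit ε r N X A B U) : meshRatio d ε ≤ 1 / 128 := by
  have h1 := h.dim_mul_meshRatio_le
  have h2 : (1 : ℝ) ≤ d := by exact_mod_cast h.one_le_dim
  have := mul_le_mul_of_nonneg_right h2 h.meshRatio_pos.le
  linarith

theorem discRatio_le (h : IsMajoritySplit ε r N X A B U) : discRatio d ε ≤ ε / 100 := by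
  have h0 := h.meshRatio_pos
  have h1 : meshRatio d ε ≤ ε := by
    have := meshRatio_mul d ε
    have h20 : (1 : ℝ) ≤ 20 ^ d := one_le_pow₀ (by norm_num)
    have := mul_le_mul_of_nonneg_left h20 h0.le
    have := h.eps_pos
    linarith
  have h2 : (1 : ℝ) ≤ 2 ^ d := one_le_pow₀ (by norm_num)
  unfold discRatio
  rw [div_le_div_iff₀ (by positivity) (by norm_num)]
  have := h.eps_pos
  nlinarith

theorem exists_of_mem_cellHull (h : IsMajoritySplit ε r N X A B U)
    {T : Set (EuclideanSpace ℝ (Fin d))} {y : EuclideanSpace ℝ (Fin d)} (hy : y ∈ cellHull N T) :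
    ∃ x ∈ T, x ∈ unitCube d ∧ dist x y ≤ meshRatio d ε * r := by
  obtain ⟨-, x, hx, hx', he⟩ := hy
  exact ⟨x, hx, hx', (dist_le_of_cellIndex_eq h.grid_pos he).trans h.mesh_le⟩

theorem half_le_ballCount (h : IsMajoritySplit ε r N X A B U) {x : EuclideanSpace ℝ (Fin d)}
    (hx : x ∈ unitCube d) : n * (r / √d) ^ d / 2 ≤ ballCount X r Set.univ x := by
  set ρ := meshRatio d ε with hρ
  have hr := h.radius_pos
  have hρ0 := h.meshRatio_pos
  have hρ1 := h.meshRatio_le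
  have hW := h.cellVolume_pos
  have hn : (0 : ℝ) < n := by exact_mod_cast h.card_pos
  have hr1 : r * (1 - ρ) ≤ r := by nlinarith
  have hr0 : 0 ≤ r * (1 - ρ) := mul_nonneg hr.le (by linarith)
  -- The radius is reduced by one cell diameter so that the hull of `T` stays in the `r`-ball.
  set T := Metric.closedBall x (r * (1 - ρ)) with hT
  have hsp := (abs_le.1 (h.spread x hx T
    (Metric.closedBall_subset_closedBall (by linarith)))).1
  have hvol : (1 - ρ) ^ d * (r / √d) ^ d ≤ volume.real (cellHull N T) := by
    have h1 := le_volumeReal_closedBall_inter_unitCube h.one_le_dim hx hr0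
      (hr1.trans h.radius_le)
    have h2 := measureReal_mono (μ := volume) (inter_subset_cellHull (N := N) (T := T))
      volume_cellHull_ne_top
    refine le_trans (le_of_eq ?_) (h1.trans h2)
    rw [← mul_pow]; congr 1; ring
  -- Bernoulli's inequality; the mesh is small enough that `d * ρ ≤ 1/128`.
  have hbern : 3 / 4 ≤ (1 - ρ) ^ d := by
    have h1 := one_add_mul_le_pow (a := -ρ) (by linarith) d
    have h2 := h.dim_mul_meshRatio_le
    rw [← sub_eq_add_neg] at h1
    refine le_trans ?_ h1
    rw [mul_neg]; linarith
  have hcount : (({i | X i ∈ cellHull N T} : Set (Fin n)).ncard : ℝ) ≤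
      ballCount X r Set.univ x := by
    unfold ballCount
    refine Nat.cast_le.2 (Set.ncard_le_ncard ?_ (Set.toFinite _))
    intro i hi
    refine ⟨trivial, ?_⟩
    obtain ⟨z, hz, -, hz'⟩ := h.exists_of_mem_cellHull hi
    have h1 : dist z x ≤ r * (1 - ρ) := hz
    have h2 := dist_triangle (X i) z x
    rw [dist_comm z] at hz'
    linarith
  have h3 : 3 / 4 * (r / √d) ^ d ≤ volume.real (cellHull N T) :=
    (mul_le_mul_of_nonneg_right hbern (by positivity)).trans hvol
  have h4 := mul_le_mul_of_nonneg_left h3 hn.le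
  have h5 := mul_le_mul_of_nonneg_right h.discRatio_le hW.le
  have h6 := mul_le_mul_of_nonneg_right h.eps_le hW.le
  linarith

/-- A point counted in only one of the two balls lies in a thin annulus around `x`. Its hull has
volume at most `ε/16 * W`, and the discrepancy adds at most `ε/100 * W`. As `A` and `B` are
disjoint, their two changes together are bounded by one count of the annulus. -/
theorem abs_ballCount_sub_le (h : IsMajoritySplit ε r N X A B U) {x y : EuclideanSpace ℝ (Fin d)}
    (hx : x ∈ unitCube d) (hxy : dist x y ≤ meshRatio d ε * r) :
    |(ballCount X r A x - ballCount X r B x) - (ballCount X r A y - ballCount X r B y)| ≤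
      ε / 8 * (n * (r / √d) ^ d) := by
  set ρ := meshRatio d ε with hρ
  have hr := h.radius_pos
  have hρ0 := h.meshRatio_pos
  have hρ1 := h.meshRatio_le
  have hW := h.cellVolume_pos
  have hn : (0 : ℝ) < n := by exact_mod_cast h.card_pos
  set T := {z | r * (1 - ρ) ≤ dist z x ∧ dist z x ≤ r * (1 + ρ)} with hT
  have hTsub : T ⊆ Metric.closedBall x (2 * r) := fun z hz => by
    have := hz.2
    rw [Metric.mem_closedBall]; nlinarith
  have hsp := (abs_le.1 (h.spread x hx T hTsub)).2
  have hvol : volume.real (cellHull N T) ≤ ε / 16 * (r / √d) ^ d := by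
    have hsub : cellHull N T ⊆ {z | r * (1 - 2 * ρ) ≤ dist z x ∧ dist z x ≤ r * (1 + 2 * ρ)} := by
      intro z hz
      obtain ⟨w, hw, -, hw'⟩ := h.exists_of_mem_cellHull hz
      have h1 : r * (1 - ρ) ≤ dist w x ∧ dist w x ≤ r * (1 + ρ) := hw
      have h2 := dist_triangle z w x
      have h3 := dist_triangle w z x
      rw [dist_comm z w] at h2
      simp only [Set.mem_ofPred_eq]
      constructor <;> linarith [h1.1, h1.2]
    have hfin : volume {z | r * (1 - 2 * ρ) ≤ dist z x ∧ dist z x ≤ r * (1 + 2 * ρ)} ≠ ⊤ :=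
      ne_top_of_le_ne_top (measure_closedBall_lt_top (x := x) (r := r * (1 + 2 * ρ))).ne
        (measure_mono fun z hz => hz.2)
    refine (measureReal_mono hsub hfin).trans ((volumeReal_annulus_le h.one_le_dim x hr.le
      (by linarith) (by linarith)).trans (le_of_eq ?_))
    have := meshRatio_mul d ε
    linear_combination (4 * (r / √d) ^ d) * this
  have hcount : ∀ (S : Set (Fin n)),
      |ballCount X r S x - ballCount X r S y| ≤ (({i | i ∈ S ∧ X i ∈ T} : Set (Fin n)).ncard : ℝ) := by
    intro S
    unfold ballCount
    rw [abs_le]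
    have h1 : ({i | i ∈ S ∧ dist (X i) y ≤ r} : Set (Fin n)).ncard ≤
        ({i | i ∈ S ∧ dist (X i) x ≤ r} : Set (Fin n)).ncard +
        ({i | i ∈ S ∧ X i ∈ T} : Set (Fin n)).ncard := by
      refine (Set.ncard_le_ncard ?_ (Set.toFinite _)).trans (Set.ncard_union_le _ _)
      rintro i ⟨hi, hi'⟩
      by_cases hc : dist (X i) x ≤ r
      · exact Or.inl ⟨hi, hc⟩
      · refine Or.inr ⟨hi, ?_, ?_⟩
        · nlinarith
        · have := dist_triangle (X i) y x
          rw [dist_comm y x] at this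
          linarith
    have h2 : ({i | i ∈ S ∧ dist (X i) x ≤ r} : Set (Fin n)).ncard ≤
        ({i | i ∈ S ∧ dist (X i) y ≤ r} : Set (Fin n)).ncard +
        ({i | i ∈ S ∧ X i ∈ T} : Set (Fin n)).ncard := by
      refine (Set.ncard_le_ncard ?_ (Set.toFinite _)).trans (Set.ncard_union_le _ _)
      rintro i ⟨hi, hi'⟩
      by_cases hc : dist (X i) y ≤ r
      · exact Or.inl ⟨hi, hc⟩
      · refine Or.inr ⟨hi, ?_, ?_⟩
        · have := dist_triangle (X i) x y
          linarith
        · nlinarith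
    have h1' : ((_ : ℕ) : ℝ) ≤ _ := Nat.cast_le.2 h1
    have h2' : ((_ : ℕ) : ℝ) ≤ _ := Nat.cast_le.2 h2
    push_cast at h1' h2'
    constructor <;> linarith
  have hdisj : (({i | i ∈ A ∧ X i ∈ T} : Set (Fin n)).ncard : ℝ) +
      (({i | i ∈ B ∧ X i ∈ T} : Set (Fin n)).ncard : ℝ) ≤
      (({i | X i ∈ cellHull N T} : Set (Fin n)).ncard : ℝ) := by
    have hd : Disjoint ({i | i ∈ A ∧ X i ∈ T} : Set (Fin n)) {i | i ∈ B ∧ X i ∈ T} :=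
      h.disj.mono (fun _ hi => hi.1) (fun _ hi => hi.1)
    rw [← Nat.cast_add, ← Set.ncard_union_eq hd (Set.toFinite _) (Set.toFinite _)]
    refine Nat.cast_le.2 (Set.ncard_le_ncard ?_ (Set.toFinite _))
    rintro i (hi | hi) <;> exact inter_subset_cellHull ⟨hi.2, h.mem_cube i⟩
  have hA := abs_le.1 (hcount A)
  have hB := abs_le.1 (hcount B)
  have h4 := mul_le_mul_of_nonneg_left hvol hn.le
  have h5 := mul_le_mul_of_nonneg_right h.discRatio_le hW.le
  have h6 := mul_pos h.eps_pos hW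
  rw [abs_le]
  constructor <;> linarith [hA.1, hA.2, hB.1, hB.2]

/-- The majority surplus is at least `ε * n * W`, and `U` costs at most `ε/50 * n * W`. The
remaining `3/4` leaves room for moves of size `ε/8`. -/
theorem lt_ballCount_sub (h : IsMajoritySplit ε r N X A B U) {u : Fin n} (hu : u ∈ A) :
    3 / 4 * ε * (n * (r / √d) ^ d) ≤ ballCount X r A (X u) - ballCount X r B (X u) := by
  have h1 := h.majority_left u hu
  have h2 := mul_le_mul_of_nonneg_left (h.half_le_ballCount (h.mem_cube u)) h.eps_pos.le
  have h3 := h.card_le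
  have h5 := mul_le_mul_of_nonneg_right h.discRatio_le h.cellVolume_pos.le
  have h6 := mul_pos h.eps_pos h.cellVolume_pos
  linarith

/-- A fine enough subdivision of a segment from an `A`-dominated place to a `B`-dominated one
contains a balanced place. -/
theorem exists_balanced_on_segment (h : IsMajoritySplit ε r N X A B U)
    {x y : EuclideanSpace ℝ (Fin d)} (hx : x ∈ unitCube d) (hy : y ∈ unitCube d)
    (hgx : 0 < ballCount X r A x - ballCount X r B x)
    (hgy : ballCount X r A y - ballCount X r B y < 0) {m : ℕ} (hm : 0 < m)
    (hd : dist x y ≤ m * (meshRatio d ε * r)) :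
    ∃ i ∈ Finset.range (m + 1),
      |ballCount X r A ((1 - (i : ℝ) / m) • x + ((i : ℝ) / m) • y) -
        ballCount X r B ((1 - (i : ℝ) / m) • x + ((i : ℝ) / m) • y)| ≤
      ε / 8 * (n * (r / √d) ^ d) := by
  have hm' : (0 : ℝ) < m := by exact_mod_cast hm
  set p : ℕ → EuclideanSpace ℝ (Fin d) := fun i => (1 - (i : ℝ) / m) • x + ((i : ℝ) / m) • y with hp
  refine exists_abs_le_of_sign_change
    (f := fun i => ballCount X r A (p i) - ballCount X r B (p i)) ?_ ?_ ?_
  · simpa [hp] using hgx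
  · simpa [hp, div_self hm'.ne'] using hgy
  · intro i hi
    have hi' : (i : ℝ) / m ≤ 1 := (div_le_one hm').2 (by exact_mod_cast hi.le)
    refine h.abs_ballCount_sub_le ?_ ?_
    · exact convex_unitCube d hx hy (by linarith) (by positivity) (by ring)
    · have e : p i - p (i + 1) = (1 / (m : ℝ)) • (x - y) := by
        simp only [hp]; push_cast; rw [add_div]; module
      rw [dist_eq_norm, e, norm_smul, ← dist_eq_norm, Real.norm_eq_abs,
        abs_of_pos (by positivity), one_div, inv_mul_le_iff₀ hm']
      exact hd

/-- The cells of the points of `A` near a balanced place have a large volume. -/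
theorem le_volume_cellHull_of_balanced (h : IsMajoritySplit ε r N X A B U)
    {x : EuclideanSpace ℝ (Fin d)} (hx : x ∈ unitCube d)
    (hbal : |ballCount X r A x - ballCount X r B x| ≤ ε / 8 * (n * (r / √d) ^ d)) :
    (r / √d) ^ d / 16 ≤ volume.real (cellHull N {z | ∃ i ∈ A, X i = z ∧ dist (X i) x ≤ r}) := by
  set T := {z | ∃ i ∈ A, X i = z ∧ dist (X i) x ≤ r} with hT
  have hn : (0 : ℝ) < n := by exact_mod_cast h.card_pos
  have hsp := (abs_le.1 (h.spread x hx T (by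
    rintro _ ⟨i, -, rfl, hi⟩
    rw [Metric.mem_closedBall]; linarith [h.radius_pos]))).2
  have htot : ballCount X r Set.univ x ≤
      ballCount X r A x + ballCount X r B x + (U.ncard : ℝ) := by
    unfold ballCount
    rw [← Nat.cast_add, ← Nat.cast_add]
    refine Nat.cast_le.2 (le_trans (Set.ncard_le_ncard ?_ (Set.toFinite _))
      ((Set.ncard_union_le ({i | i ∈ A ∧ dist (X i) x ≤ r} ∪ {i | i ∈ B ∧ dist (X i) x ≤ r})
        U).trans (Nat.add_le_add_right (Set.ncard_union_le _ _) _)))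
    rintro i ⟨-, hi⟩
    rcases h.cover i with hc | hc | hc
    · exact Or.inl (Or.inl ⟨hc, hi⟩)
    · exact Or.inl (Or.inr ⟨hc, hi⟩)
    · exact Or.inr hc
  have hA : ballCount X r A x ≤ (({i | X i ∈ cellHull N T} : Set (Fin n)).ncard : ℝ) := by
    unfold ballCount
    refine Nat.cast_le.2 (Set.ncard_le_ncard ?_ (Set.toFinite _))
    rintro i ⟨hi, hi'⟩
    exact inter_subset_cellHull ⟨⟨i, hi, rfl, hi'⟩, h.mem_cube i⟩
  have h1 := h.half_le_ballCount hx
  have h3 := h.card_le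
  have h5 := mul_le_mul_of_nonneg_right h.discRatio_le h.cellVolume_pos.le
  have h6 := mul_le_mul_of_nonneg_right h.eps_le h.cellVolume_pos.le
  have h7 := h.cellVolume_pos
  have h8 := (abs_le.1 hbal).1
  refine le_of_mul_le_mul_left ?_ hn
  linarith

/-- In the hull `|g|` is at most `ε/8 + ε/8` times `n * W`, below the `3/4 * ε * n * W` forced at
points of `A` and `B`. So only points of `U` lie there; even spreading turns this count into a
volume bound. -/
theorem volume_cellHull_balanced_le (h : IsMajoritySplit ε r N X A B U)
    {x : EuclideanSpace ℝ (Fin d)} (hx : x ∈ unitCube d) :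
    volume.real (cellHull N {z | |ballCount X r A z - ballCount X r B z| ≤
        ε / 8 * (n * (r / √d) ^ d) ∧ dist z x ≤ 2 * r}) ≤
      2 * (discRatio d ε * (r / √d) ^ d) := by
  set T := {z | |ballCount X r A z - ballCount X r B z| ≤
        ε / 8 * (n * (r / √d) ^ d) ∧ dist z x ≤ 2 * r} with hT
  have hn : (0 : ℝ) < n := by exact_mod_cast h.card_pos
  have hsp := (abs_le.1 (h.spread x hx T (fun z hz => hz.2))).1
  have hU : (({i | X i ∈ cellHull N T} : Set (Fin n)).ncard : ℝ) ≤ U.ncard := by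
    refine Nat.cast_le.2 (Set.ncard_le_ncard ?_ (Set.toFinite _))
    intro i hi
    obtain ⟨w, hw, hwc, hw'⟩ := h.exists_of_mem_cellHull hi
    have h1 := abs_le.1 (h.abs_ballCount_sub_le hwc hw')
    have h2 := abs_le.1 hw.1
    have h6 := mul_pos h.eps_pos h.cellVolume_pos
    rcases h.cover i with hc | hc | hc
    · have := h.lt_ballCount_sub hc
      linarith [h1.1, h2.2]
    · have := h.symm.lt_ballCount_sub hc
      linarith [h1.2, h2.1]
    · exact hc
  have h3 := h.card_le
  refine le_of_mul_le_mul_left ?_ hn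
  linarith

theorem eq_empty (h : IsMajoritySplit ε r N X A B U) : A = ∅ ∨ B = ∅ := by
  by_contra hne
  rw [not_or, ← Ne, ← Ne, ← Set.nonempty_iff_ne_empty, ← Set.nonempty_iff_ne_empty] at hne
  obtain ⟨⟨u, hu⟩, ⟨v, hv⟩⟩ := hne
  set ρ := meshRatio d ε with hρ
  have hr := h.radius_pos
  have hρ0 := h.meshRatio_pos
  have hρ1 := h.meshRatio_le
  have hρr : 0 < ρ * r := by positivity
  have hpos := mul_pos h.eps_pos h.cellVolume_pos
  have hd0 : 0 < √(d : ℝ) := Real.sqrt_pos.2 (by exact_mod_cast h.one_le_dim)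
  have hW : 0 < (r / √d) ^ d := by positivity
  obtain ⟨x₀, hx₀, hbal⟩ : ∃ x ∈ unitCube d,
      |ballCount X r A x - ballCount X r B x| ≤ ε / 8 * (n * (r / √d) ^ d) := by
    set m := ⌈dist (X u) (X v) / (ρ * r)⌉₊ + 1 with hm
    have hm0 : (0 : ℝ) < m := by rw [hm]; positivity
    have hu' := h.lt_ballCount_sub hu
    have hv' := h.symm.lt_ballCount_sub hv
    obtain ⟨i, hi, hb⟩ := h.exists_balanced_on_segment (h.mem_cube u) (h.mem_cube v)
      (by linarith) (by linarith) (m := m) (Nat.succ_pos _) (by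
        rw [← div_le_iff₀ hρr]
        refine (Nat.le_ceil _).trans ?_
        rw [hm]; push_cast; linarith)
    refine ⟨_, ?_, hb⟩
    have hi' : (i : ℝ) / m ≤ 1 :=
      (div_le_one hm0).2 (by exact_mod_cast Nat.lt_succ_iff.1 (Finset.mem_range.1 hi))
    exact convex_unitCube d (h.mem_cube u) (h.mem_cube v) (by linarith) (by positivity) (by ring)
  set TA := {z | ∃ i ∈ A, X i = z ∧ dist (X i) x₀ ≤ r} with hTA
  set TB := {z | ∃ i ∈ B, X i = z ∧ dist (X i) x₀ ≤ r} with hTB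
  set TM := {z | |ballCount X r A z - ballCount X r B z| ≤
        ε / 8 * (n * (r / √d) ^ d) ∧ dist z x₀ ≤ 2 * r} with hTM
  have hvA := h.le_volume_cellHull_of_balanced hx₀ hbal
  have hvB := h.symm.le_volume_cellHull_of_balanced hx₀ (by rwa [abs_sub_comm])
  have hvM := h.volume_cellHull_balanced_le hx₀
  rw [← hTA] at hvA
  rw [← hTB] at hvB
  rw [← hTM] at hvM
  -- Both regions lie within `2 * r` of `x₀`, so segments have length at most `4 * r` and `4 / ρ`
  -- steps of size `ρ * r` suffice.
  set m := ⌈4 / ρ⌉₊ with hm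
  have hm4 : 4 / ρ ≤ m := Nat.le_ceil _
  have hm0 : (0 : ℝ) < m := lt_of_lt_of_le (by positivity) hm4
  have hmle : (m : ℝ) + 1 ≤ 5 / ρ := by
    have h1 := (Nat.ceil_lt_add_one (a := 4 / ρ) (by positivity)).le
    have h2 : 2 ≤ 1 / ρ := by rw [le_div_iff₀ hρ0]; linarith
    have h3 : 5 / ρ = 4 / ρ + 1 / ρ := by ring
    rw [h3]; linarith
  have hball : ∀ z, (z ∈ cellHull N TA ∨ z ∈ cellHull N TB) → dist z x₀ ≤ 2 * r := by
    rintro z (hz | hz) <;>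
    · obtain ⟨w, ⟨i, -, rfl, hi⟩, -, hw⟩ := h.exists_of_mem_cellHull hz
      have h1 := dist_triangle z (X i) x₀
      rw [dist_comm z (X i)] at h1
      nlinarith
  have hmin := min_volume_le_of_segments_meet (m := m) (A := cellHull N TA) (B := cellHull N TB)
    (M := cellHull N TM) measurableSet_cellHull measurableSet_cellHull measurableSet_cellHull
    volume_cellHull_ne_top volume_cellHull_ne_top (by
      intro x hx y hy
      have hgx : 0 < ballCount X r A x - ballCount X r B x := by
        obtain ⟨w, ⟨i, hi, rfl, -⟩, hwc, hw⟩ := h.exists_of_mem_cellHull hx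
        have h1 := (abs_le.1 (h.abs_ballCount_sub_le hwc hw)).2
        have h2 := h.lt_ballCount_sub hi
        linarith
      have hgy : ballCount X r A y - ballCount X r B y < 0 := by
        obtain ⟨w, ⟨i, hi, rfl, -⟩, hwc, hw⟩ := h.exists_of_mem_cellHull hy
        have h1 := (abs_le.1 (h.abs_ballCount_sub_le hwc hw)).1
        have h2 := h.symm.lt_ballCount_sub hi
        linarith
      have hxc := cellHull_subset_unitCube hx
      have hyc := cellHull_subset_unitCube hy
      have hbx := hball x (Or.inl hx)
      have hby := hball y (Or.inr hy)
      obtain ⟨i, hi, hb⟩ := h.exists_balanced_on_segment hxc hyc hgx hgy (m := m)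
        (by exact_mod_cast hm0) (by
          have h1 := dist_triangle_right x y x₀
          have h2 : 4 ≤ m * ρ := by rwa [div_le_iff₀ hρ0] at hm4
          nlinarith)
      have hi' : (i : ℝ) / m ≤ 1 :=
        (div_le_one hm0).2 (by exact_mod_cast Nat.lt_succ_iff.1 (Finset.mem_range.1 hi))
      refine ⟨i, hi, inter_subset_cellHull ⟨⟨hb, ?_⟩, ?_⟩⟩
      · exact convex_closedBall x₀ (2 * r) (Metric.mem_closedBall.2 hbx)
          (Metric.mem_closedBall.2 hby) (by linarith) (by positivity) (by ring)
      · exact convex_unitCube d hxc hyc (by linarith) (by positivity) (by ring))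
  have hminr : (r / √d) ^ d / 16 ≤ (m + 1) * (2 ^ d * volume.real (cellHull N TM)) := by
    have hfin : ((m : ENNReal) + 1) * (2 ^ d * volume (cellHull N TM)) ≠ ⊤ :=
      ENNReal.mul_ne_top (by simp) (ENNReal.mul_ne_top (by simp) volume_cellHull_ne_top)
    have e : (m + 1) * (2 ^ d * volume.real (cellHull N TM)) =
        (((m : ENNReal) + 1) * (2 ^ d * volume (cellHull N TM))).toReal := by
      rw [ENNReal.toReal_mul, ENNReal.toReal_mul, ENNReal.toReal_pow, measureReal_def,
        ENNReal.toReal_add (by simp) (by simp)]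
      simp
    rw [e]
    rcases min_le_iff.1 hmin with h1 | h1
    · exact hvA.trans (ENNReal.toReal_mono hfin h1)
    · exact hvB.trans (ENNReal.toReal_mono hfin h1)
  -- The `200 * 2 ^ d` in `discRatio` is chosen for this: `5/ρ * 2^d * 2 * discRatio` equals `1/20`,
  -- less than the `1/16` of the lower bound.
  have hfinal : (m + 1) * (2 ^ d * volume.real (cellHull N TM)) ≤ (r / √d) ^ d / 20 := by
    calc (m + 1) * (2 ^ d * volume.real (cellHull N TM))
        ≤ 5 / ρ * (2 ^ d * (2 * (discRatio d ε * (r / √d) ^ d))) := by gcongr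
      _ = (r / √d) ^ d / 20 := by
        have hne : ρ ≠ 0 := hρ0.ne'
        unfold discRatio; rw [← hρ]; field_simp; norm_num
  linarith

end

end IsMajoritySplit

/-! ### From a disconnecting vertex set to a majority split. -/

section Graphs

theorem exists_split_of_not_connected {V : Type*} (H : SimpleGraph V) {U : Set V}
    (hU : Uᶜ.Nonempty) (h : ¬ (H.induce Uᶜ).Connected) :
    ∃ A B : Set V, A.Nonempty ∧ B.Nonempty ∧ Disjoint A B ∧ (∀ v, v ∈ A ∨ v ∈ B ∨ v ∈ U) ∧
      ∀ a ∈ A, ∀ b ∈ B, ¬ H.Adj a b := by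
  have hne : Nonempty ↥(Uᶜ : Set V) := hU.to_subtype
  have hp : ¬ (H.induce Uᶜ).Preconnected := fun hp => h ⟨hp⟩
  unfold SimpleGraph.Preconnected at hp
  push Not at hp
  obtain ⟨a, b, hab⟩ := hp
  refine ⟨Subtype.val '' {w | (H.induce Uᶜ).Reachable a w},
    Subtype.val '' {w | ¬ (H.induce Uᶜ).Reachable a w},
    ⟨a, a, SimpleGraph.Reachable.refl a, rfl⟩, ⟨b, b, hab, rfl⟩, ?_, ?_, ?_⟩
  · rw [Set.disjoint_left]
    rintro _ ⟨w, hw, rfl⟩ ⟨w', hw', he⟩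
    rw [Subtype.val_injective he] at hw'
    exact hw' hw
  · intro v
    by_cases hv : v ∈ U
    · exact Or.inr (Or.inr hv)
    · by_cases hr : (H.induce Uᶜ).Reachable a ⟨v, hv⟩
      · exact Or.inl ⟨⟨v, hv⟩, hr, rfl⟩
      · exact Or.inr (Or.inl ⟨⟨v, hv⟩, hr, rfl⟩)
  · rintro _ ⟨x, hx, rfl⟩ _ ⟨y, hy, rfl⟩ hadj
    exact hy (SimpleGraph.Reachable.trans hx (SimpleGraph.Adj.reachable
      (G := H.induce Uᶜ) (u := x) (v := y) hadj))

/-- All `H`-neighbours of `u` lie in `A` or `U`, so `A` holds more than half of the ball up to `U`.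
Ball counts include `u` itself while degrees do not; the resulting correction `1 - 2ε` is
nonnegative because `ε ≤ 1/2`. -/
theorem majority_of_isAlphaSubgraph {d n : ℕ} {ε r : ℝ} (hε : ε ≤ 1 / 2) (hr : 0 ≤ r)
    {X : Fin n → EuclideanSpace ℝ (Fin d)} {H : SimpleGraph (Fin n)}
    (hH : IsAlphaSubgraph (1 / 2 + ε) H (geomGraph X r)) (hε0 : 0 ≤ ε) {A B U : Set (Fin n)}
    (hAB : Disjoint A B) (hcov : ∀ v, v ∈ A ∨ v ∈ B ∨ v ∈ U)
    (hno : ∀ a ∈ A, ∀ b ∈ B, ¬ H.Adj a b) {u : Fin n} (hu : u ∈ A) :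
    2 * ε * ballCount X r Set.univ (X u) - 2 * U.ncard ≤
      ballCount X r A (X u) - ballCount X r B (X u) := by
  have hsum : ballCount X r A (X u) + ballCount X r B (X u) ≤ ballCount X r Set.univ (X u) := by
    unfold ballCount
    rw [← Nat.cast_add, ← Set.ncard_union_eq (hAB.mono (fun _ hi => hi.1) (fun _ hi => hi.1))
      (Set.toFinite _) (Set.toFinite _)]
    refine Nat.cast_le.2 (Set.ncard_le_ncard ?_ (Set.toFinite _))
    rintro i (hi | hi) <;> exact ⟨trivial, hi.2⟩
  have hdeg : ballCount X r Set.univ (X u) ≤ (((geomGraph X r).neighborSet u).ncard : ℝ) + 1 := by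
    unfold ballCount
    rw [← Nat.cast_one, ← Nat.cast_add]
    refine Nat.cast_le.2 ((Set.ncard_le_ncard ?_ (Set.toFinite _)).trans (Set.ncard_insert_le u _))
    rintro i ⟨-, hi⟩
    by_cases hiu : i = u
    · exact Or.inl hiu
    · refine Or.inr ⟨Ne.symm hiu, ?_⟩
      rwa [dist_comm]
  have hHdeg : ((H.neighborSet u).ncard : ℝ) + 1 ≤ ballCount X r A (X u) + U.ncard := by
    have hmem : u ∈ {i | i ∈ A ∧ dist (X i) (X u) ≤ r} := ⟨hu, by simpa using hr⟩
    have h1 := Set.ncard_sdiff_singleton_add_one hmem (Set.toFinite _)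
    have h2 : (H.neighborSet u).ncard ≤
        ({i | i ∈ A ∧ dist (X i) (X u) ≤ r} \ {u}).ncard + U.ncard := by
      refine (Set.ncard_le_ncard ?_ (Set.toFinite _)).trans (Set.ncard_union_le _ _)
      intro i hi
      have hi' : H.Adj u i := hi
      have hG : u ≠ i ∧ dist (X u) (X i) ≤ r := hH.1 hi'
      rcases hcov i with hc | hc | hc
      · refine Or.inl ⟨⟨hc, ?_⟩, fun h => hG.1 h.symm⟩
        rw [dist_comm]; exact hG.2
      · exact absurd hi' (hno u hu i hc)
      · exact Or.inr hc
    unfold ballCount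
    rw [← h1]
    have h2' : ((_ : ℕ) : ℝ) ≤ _ := Nat.cast_le.2 h2
    push_cast at h2' ⊢
    linarith
  have hα := hH.2 u
  have h3 := mul_le_mul_of_nonneg_left hdeg (by linarith : (0 : ℝ) ≤ 1 / 2 + ε)
  nlinarith

/-- The constant in the connectivity of the subgraphs. -/
noncomputable def connRatio (d : ℕ) (ε : ℝ) : ℝ := discRatio d ε / √d ^ d

theorem isKConnected_of_evenlySpread {d n N : ℕ} (hd : 1 ≤ d) (hn : 2 ≤ n) {ε r : ℝ} (hε : 0 < ε)
    (hε' : ε ≤ 1 / 2) (hr : 0 < r) (hr' : r ≤ √d) (hN : 0 < N) (hmesh : √d / N ≤ meshRatio d ε * r)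
    {X : Fin n → EuclideanSpace ℝ (Fin d)} (hX : ∀ i, X i ∈ unitCube d)
    (hs : EvenlySpread X N r (discRatio d ε * (r / √d) ^ d)) {H : SimpleGraph (Fin n)}
    (hH : IsAlphaSubgraph (1 / 2 + ε) H (geomGraph X r)) :
    IsKConnected H ⌈connRatio d ε * r ^ d * (n : ℝ)⌉₊ := by
  have hk : connRatio d ε * r ^ d * (n : ℝ) = n * (discRatio d ε * (r / √d) ^ d) := by
    unfold connRatio; rw [div_pow]; ring
  have hd0 : 0 < √(d : ℝ) := Real.sqrt_pos.2 (by exact_mod_cast hd)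
  have hn2 : (2 : ℝ) ≤ n := by exact_mod_cast hn
  have hγ0 : 0 ≤ discRatio d ε := by unfold discRatio meshRatio; positivity
  have hγ : discRatio d ε ≤ 1 / 2 := by
    have h1 : (1 : ℝ) ≤ 20 ^ d := one_le_pow₀ (by norm_num)
    have h2 : (1 : ℝ) ≤ 2 ^ d := one_le_pow₀ (by norm_num)
    unfold discRatio meshRatio
    rw [div_div]
    refine (div_le_self hε.le ?_).trans hε'
    nlinarith
  have hW1 : (r / √d) ^ d ≤ 1 := pow_le_one₀ (by positivity) ((div_le_one hd0).2 hr')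
  have hx0 : 0 ≤ n * (discRatio d ε * (r / √d) ^ d) := by positivity
  have hlt : ⌈connRatio d ε * r ^ d * (n : ℝ)⌉₊ < n := by
    rw [hk]
    have h1 := Nat.ceil_lt_add_one hx0
    have h2 : discRatio d ε * (r / √d) ^ d ≤ 1 / 2 :=
      (mul_le_of_le_one_right hγ0 hW1).trans hγ
    have h3 := mul_le_mul_of_nonneg_left h2 (by linarith : (0 : ℝ) ≤ n)
    have h4 : ((⌈n * (discRatio d ε * (r / √d) ^ d)⌉₊ : ℕ) : ℝ) < n := by linarith
    exact_mod_cast h4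
  refine ⟨by simpa using hlt, fun U hU => ?_⟩
  by_contra hcon
  have hne : ((U : Set (Fin n))ᶜ).Nonempty := by
    by_contra hemp
    rw [Set.not_nonempty_iff_eq_empty, Set.compl_empty_iff, Finset.coe_eq_univ] at hemp
    rw [hemp, Finset.card_univ, Fintype.card_fin] at hU
    omega
  obtain ⟨A, B, hA, hB, hAB, hcov, hno⟩ := exists_split_of_not_connected H hne hcon
  have hsplit : IsMajoritySplit ε r N X A B (U : Set (Fin n)) :=
    { one_le_dim := hd
      card_pos := by omega
      eps_pos := hε
      eps_le := hε'
      radius_pos := hr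
      radius_le := hr'
      grid_pos := hN
      mesh_le := hmesh
      mem_cube := hX
      spread := hs
      cover := hcov
      disj := hAB
      card_le := by
        rw [Set.ncard_coe_finset, ← hk]
        exact (Nat.lt_ceil.1 hU).le
      majority_left := fun u hu => majority_of_isAlphaSubgraph hε' hr.le hH hε.le hAB hcov hno hu
      majority_right := fun u hu => majority_of_isAlphaSubgraph hε' hr.le hH hε.le hAB.symm
        (fun v => by rcases hcov v with h | h | h <;> simp [h])
        (fun b hb a ha h => hno a ha b hb h.symm) hu }
  rcases hsplit.eq_empty with h | h
  · exact hA.ne_empty h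
  · exact hB.ne_empty h

end Graphs

/-! ### Even spreading holds with high probability: union bound over cell unions. -/

section UnionBound

theorem ae_mem_unitCube (d n : ℕ) : ∀ᵐ X ∂(pointsLaw d n), ∀ i, X i ∈ unitCube d := by
  rw [ae_all_iff]
  intro i
  have h : ∀ᵐ x ∂(uniformCube d), x ∈ unitCube d :=
    ae_restrict_mem (measurableSet_unitCube d)
  exact (measurePreserving_eval (fun _ : Fin n => uniformCube d) i).quasiMeasurePreserving.ae h

/-- The union of the grid cells in the unit cube with index in `S`. -/
def cellUnion {d : ℕ} (N : ℕ) (S : Finset (Fin d → ℤ)) : Set (EuclideanSpace ℝ (Fin d)) :=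
  unitCube d ∩ cellIndex N ⁻¹' (S : Set (Fin d → ℤ))

theorem measurableSet_cellUnion {d : ℕ} (N : ℕ) (S : Finset (Fin d → ℤ)) :
    MeasurableSet (cellUnion N S) :=
  (measurableSet_unitCube d).inter (measurable_cellIndex d N S.measurableSet)

theorem uniformCube_real_cellUnion {d : ℕ} (N : ℕ) (S : Finset (Fin d → ℤ)) :
    (uniformCube d).real (cellUnion N S) = volume.real (cellUnion N S) := by
  rw [measureReal_def, measureReal_def, uniformCube,
    Measure.restrict_apply (measurableSet_cellUnion N S),
    Set.inter_eq_self_of_subset_left (show cellUnion N S ⊆ unitCube d from Set.inter_subset_left)]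

/-- The index `N` does occur, at points with a coordinate equal to `1`; hence `N + 1` values per
axis. -/
theorem cellIndex_mem_Icc {d N : ℕ} {x : EuclideanSpace ℝ (Fin d)} (hx : x ∈ unitCube d) :
    cellIndex N x ∈ Finset.Icc (0 : Fin d → ℤ) (fun _ => (N : ℤ)) := by
  rw [Finset.mem_Icc]
  constructor
  · intro i
    exact Int.floor_nonneg.2 (mul_nonneg (Nat.cast_nonneg _) (hx i).1)
  · intro i
    have h1 : (N : ℝ) * x i ≤ N := mul_le_of_le_one_right (Nat.cast_nonneg _) (hx i).2
    have h2 : ((⌊(N : ℝ) * x i⌋ : ℤ) : ℝ) ≤ ((N : ℤ) : ℝ) := (Int.floor_le _).trans (by simpa using h1)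
    exact_mod_cast h2

theorem cellIndex_mem_Icc_of_dist_le {d N M : ℕ} {x y : EuclideanSpace ℝ (Fin d)} {s : ℝ}
    (hxy : dist y x ≤ s) (hM : s * N + 1 ≤ M) :
    cellIndex N y ∈ Finset.Icc (cellIndex N x - fun _ => (M : ℤ)) (cellIndex N x + fun _ => (M : ℤ)) := by
  have key : ∀ i, |(N : ℝ) * y i - N * x i| ≤ s * N := fun i => by
    have h1 : |y i - x i| ≤ dist y x := by
      rw [dist_eq_norm]
      exact PiLp.norm_apply_le (y - x) i
    rw [← mul_sub, abs_mul, abs_of_nonneg (Nat.cast_nonneg N), mul_comm]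
    exact mul_le_mul_of_nonneg_right (h1.trans hxy) (Nat.cast_nonneg _)
  have hfl : ∀ i, |((⌊(N : ℝ) * y i⌋ : ℤ) : ℝ) - ((⌊(N : ℝ) * x i⌋ : ℤ) : ℝ)| ≤ M := fun i => by
    have h1 := abs_le.1 (key i)
    have h2 := Int.floor_le ((N : ℝ) * y i)
    have h3 := Int.lt_floor_add_one ((N : ℝ) * y i)
    have h4 := Int.floor_le ((N : ℝ) * x i)
    have h5 := Int.lt_floor_add_one ((N : ℝ) * x i)
    rw [abs_le]; constructor <;> linarith [h1.1, h1.2]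
  rw [Finset.mem_Icc]
  constructor <;> intro i
  · have h : ((⌊(N : ℝ) * x i⌋ - M : ℤ) : ℝ) ≤ ((⌊(N : ℝ) * y i⌋ : ℤ) : ℝ) := by
      push_cast; linarith [(abs_le.1 (hfl i)).1]
    exact Int.cast_le.1 h
  · have h : ((⌊(N : ℝ) * y i⌋ : ℤ) : ℝ) ≤ ((⌊(N : ℝ) * x i⌋ + M : ℤ) : ℝ) := by
      push_cast; linarith [(abs_le.1 (hfl i)).2]
    exact Int.cast_le.1 h

/-- This replaces arbitrary sets by at most `2 ^ ((2M+1)^d)` candidates per base cell. The constant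
`15` is `5 * 3`: the hull lies in a ball of radius `3 * r`. -/
theorem exists_cellHull_eq_cellUnion {d N M : ℕ} (hd : 1 ≤ d) (hN : 0 < N) {r : ℝ} (hr : 0 < r)
    (hmesh : √d / N ≤ r) (hM : 2 * r * N + 1 ≤ M) {x : EuclideanSpace ℝ (Fin d)}
    {T : Set (EuclideanSpace ℝ (Fin d))} (hT : T ⊆ Metric.closedBall x (2 * r)) :
    ∃ S ⊆ Finset.Icc (cellIndex N x - fun _ => (M : ℤ)) (cellIndex N x + fun _ => (M : ℤ)),
      cellHull N T = cellUnion N S ∧ volume.real (cellUnion N S) ≤ (15 * (r / √d)) ^ d := by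
  classical
  set I := Finset.Icc (cellIndex N x - fun _ => (M : ℤ)) (cellIndex N x + fun _ => (M : ℤ)) with hI
  have heq : cellHull N T =
      cellUnion N (I.filter fun z => ∃ y ∈ T, y ∈ unitCube d ∧ cellIndex N y = z) := by
    ext w
    simp only [cellHull, cellUnion, Set.mem_ofPred_eq, Set.mem_inter_iff, Set.mem_preimage,
      Finset.mem_coe, Finset.mem_filter]
    refine and_congr_right fun hw => ⟨fun h => ⟨?_, h⟩, fun h => h.2⟩
    obtain ⟨y, hy, -, he⟩ := h
    rw [← he]
    exact cellIndex_mem_Icc_of_dist_le (hT hy) hM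
  refine ⟨_, Finset.filter_subset _ _, heq, ?_⟩
  rw [← heq]
  have hsub : cellHull N T ⊆ Metric.closedBall x (3 * r) := by
    rintro w ⟨-, y, hy, -, he⟩
    have h1 := (dist_le_of_cellIndex_eq hN he).trans hmesh
    have h2 : dist y x ≤ 2 * r := hT hy
    have h3 := dist_triangle w y x
    rw [dist_comm w y] at h3
    rw [Metric.mem_closedBall]; linarith
  refine (measureReal_mono hsub measure_closedBall_lt_top.ne).trans
    ((volumeReal_closedBall_le hd x (by positivity)).trans (le_of_eq ?_))
  congr 1; ring

theorem measureReal_not_evenlySpread_le {d n N M : ℕ} (hd : 1 ≤ d) (hN : 0 < N) {r a : ℝ}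
    (hr : 0 < r) (hmesh : √d / N ≤ r) (hM : 2 * r * N + 1 ≤ M) (ha : 0 ≤ a)
    (ha' : a ≤ 2 * (15 * (r / √d)) ^ d) :
    (pointsLaw d n).real {X | ¬ EvenlySpread X N r a} ≤
      ((N : ℝ) + 1) ^ d * 2 ^ ((2 * M + 1) ^ d) *
        (2 * Real.exp (-(n * a ^ 2 / (4 * (15 * (r / √d)) ^ d)))) := by
  classical
  have hd0 : 0 < √(d : ℝ) := Real.sqrt_pos.2 (by exact_mod_cast hd)
  set p := (15 * (r / √d)) ^ d with hp
  have hp0 : 0 < p := by positivity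
  set bad : Finset (Fin d → ℤ) → Set (Fin n → EuclideanSpace ℝ (Fin d)) := fun S =>
    {X | n * a < |(({i | X i ∈ cellUnion N S} : Set (Fin n)).ncard : ℝ) -
      n * (uniformCube d).real (cellUnion N S)|} with hbad
  set W : (Fin d → ℤ) → Finset (Finset (Fin d → ℤ)) := fun z =>
    (Finset.Icc (z - fun _ => (M : ℤ)) (z + fun _ => (M : ℤ))).powerset.filter
      fun S => volume.real (cellUnion N S) ≤ p with hW
  set Z := Finset.Icc (0 : Fin d → ℤ) (fun _ => (N : ℤ)) with hZ
  have hsub : {X : Fin n → EuclideanSpace ℝ (Fin d) | ¬ EvenlySpread X N r a} ⊆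
      ⋃ z ∈ Z, ⋃ S ∈ W z, bad S := by
    intro X hX
    have hX' : ¬ EvenlySpread X N r a := hX
    unfold EvenlySpread at hX'
    push Not at hX'
    obtain ⟨x, hx, T, hT, hlt⟩ := hX'
    obtain ⟨S, hS, heq, hvol⟩ := exists_cellHull_eq_cellUnion hd hN hr hmesh hM hT
    refine Set.mem_biUnion (cellIndex_mem_Icc hx) (Set.mem_biUnion (x := S) ?_ ?_)
    · exact Finset.mem_filter.2 ⟨Finset.mem_powerset.2 hS, hvol⟩
    · rw [heq, ← uniformCube_real_cellUnion] at hlt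
      exact hlt
  have hbound : ∀ z, ∀ S ∈ W z, (pointsLaw d n).real (bad S) ≤
      2 * Real.exp (-(n * a ^ 2 / (4 * p))) := by
    intro z S hS
    have hv := (Finset.mem_filter.1 hS).2
    rw [← uniformCube_real_cellUnion] at hv
    exact measureReal_ncard_deviation_le (uniformCube d) (measurableSet_cellUnion N S) n hp0 ha
      ha' hv
  have hWcard : ∀ z, ((W z).card : ℝ) ≤ 2 ^ ((2 * M + 1) ^ d) := by
    intro z
    have h1 : (W z).card ≤ 2 ^ ((2 * M + 1) ^ d) := by
      refine (Finset.card_filter_le _ _).trans (le_of_eq ?_)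
      rw [Finset.card_powerset, Pi.card_Icc]
      congr 1
      rw [Finset.prod_congr rfl (fun i _ => show _ = 2 * M + 1 from ?_), Finset.prod_const,
        Finset.card_univ, Fintype.card_fin]
      rw [Int.card_Icc]
      simp only [Pi.add_apply, Pi.sub_apply]
      omega
    exact_mod_cast h1
  have hZcard : (Z.card : ℝ) = ((N : ℝ) + 1) ^ d := by
    have h1 : Z.card = (N + 1) ^ d := by
      rw [hZ, Pi.card_Icc]
      rw [Finset.prod_congr rfl (fun i _ => show _ = N + 1 from ?_), Finset.prod_const,
        Finset.card_univ, Fintype.card_fin]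
      rw [Int.card_Icc]
      simp only [Pi.zero_apply]
      omega
    rw [h1]; push_cast; rfl
  set e := 2 * Real.exp (-(n * a ^ 2 / (4 * p))) with he
  have he0 : 0 ≤ e := by positivity
  calc (pointsLaw d n).real {X | ¬ EvenlySpread X N r a}
      ≤ (pointsLaw d n).real (⋃ z ∈ Z, ⋃ S ∈ W z, bad S) :=
        measureReal_mono hsub (measure_ne_top _ _)
    _ ≤ ∑ z ∈ Z, (pointsLaw d n).real (⋃ S ∈ W z, bad S) := measureReal_biUnion_finset_le _ _
    _ ≤ ∑ z ∈ Z, ∑ S ∈ W z, (pointsLaw d n).real (bad S) :=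
        Finset.sum_le_sum fun z _ => measureReal_biUnion_finset_le _ _
    _ ≤ ∑ z ∈ Z, ∑ _S ∈ W z, e :=
        Finset.sum_le_sum fun z _ => Finset.sum_le_sum fun S hS => hbound z S hS
    _ ≤ ∑ _z ∈ Z, 2 ^ ((2 * M + 1) ^ d) * e := by
        refine Finset.sum_le_sum fun z _ => ?_
        rw [Finset.sum_const, nsmul_eq_mul]
        exact mul_le_mul_of_nonneg_right (hWcard z) he0
    _ = _ := by rw [Finset.sum_const, nsmul_eq_mul, hZcard]; ring

end UnionBound

/-! ### The radius constant and the failure probability. -/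

/-- The absolute constant in the radius bound. -/
noncomputable def radiusConst : ℝ := 8 * 12800 ^ 2 * 24000

theorem log_le_of_radiusBound_le {d n : ℕ} (hd : 1 ≤ d) (hn : 2 ≤ n) {ε r K : ℝ} (hε : 0 < ε)
    (hK : 0 ≤ K)
    (h : radiusBound (K * ε ^ (-2 / (d : ℝ)) * √(d : ℝ)) d n ≤ r) :
    K ^ d * (ε ^ 2)⁻¹ * Real.log n ≤ n * (r / √d) ^ d := by
  have hd0 : 0 < √(d : ℝ) := Real.sqrt_pos.2 (by exact_mod_cast hd)
  have hdne : (d : ℝ) ≠ 0 := by positivity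
  have hn0 : (0 : ℝ) < n := by positivity
  have hlog : 0 ≤ Real.log n / n := div_nonneg (Real.log_natCast_nonneg n) hn0.le
  have h1 : K * ε ^ (-2 / (d : ℝ)) * (Real.log n / n) ^ ((1 : ℝ) / d) ≤ r / √d := by
    rw [le_div_iff₀ hd0]
    refine le_trans (le_of_eq ?_) h
    unfold radiusBound; ring
  have h2 := pow_le_pow_left₀ (by positivity) h1 d
  have e1 : (ε ^ (-2 / (d : ℝ))) ^ d = (ε ^ 2)⁻¹ := by
    rw [← Real.rpow_mul_natCast hε.le, div_mul_cancel₀ _ hdne, Real.rpow_neg hε.le]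
    norm_num
  have e2 : ((Real.log n / n) ^ ((1 : ℝ) / d)) ^ d = Real.log n / n := by
    rw [← Real.rpow_mul_natCast hlog, div_mul_cancel₀ _ hdne, Real.rpow_one]
  rw [mul_pow, mul_pow, e1, e2] at h2
  calc K ^ d * (ε ^ 2)⁻¹ * Real.log n = n * (K ^ d * (ε ^ 2)⁻¹ * (Real.log n / n)) := by
        field_simp
    _ ≤ _ := by gcongr

/-- The prefactor, needed only once, is paid `d` times; this keeps the constant independent of `d`.
-/
theorem radiusConst_pow_ge {d : ℕ} (hd : 1 ≤ d) :
    8 * 12800 ^ 2 * 24000 ^ d ≤ radiusConst ^ d := by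
  unfold radiusConst
  rw [mul_pow]
  have := pow_le_pow_right₀ (by norm_num : (1 : ℝ) ≤ 8 * 12800 ^ 2) hd
  rw [pow_one] at this
  gcongr

/-- Above the radius bound, the points are evenly spread up to an event of probability `O(1/n)`. -/
theorem measureReal_not_evenlySpread_le_div {d n N M : ℕ} (hd : 1 ≤ d) (hn : 3 ≤ n) {ε r : ℝ}
    (hε : 0 < ε) (hε' : ε ≤ 1 / 2) (hr : 0 < r) (hr' : r ≤ √d)
    (h : radiusBound (radiusConst * ε ^ (-2 / (d : ℝ)) * √(d : ℝ)) d n ≤ r)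
    (hN : N = ⌈√d / (meshRatio d ε * r)⌉₊)
    (hM : M = ⌈2 * √d / meshRatio d ε + 2 * √d + 1⌉₊) :
    0 < N ∧ √d / N ≤ meshRatio d ε * r ∧
    (pointsLaw d n).real {X | ¬ EvenlySpread X N r (discRatio d ε * (r / √d) ^ d)} ≤
      (1 / meshRatio d ε + 2) ^ d * 2 ^ ((2 * M + 1) ^ d) * 2 / n := by
  have hd0 : 0 < √(d : ℝ) := Real.sqrt_pos.2 (by exact_mod_cast hd)
  have hn0 : (0 : ℝ) < n := by positivity
  have hlog1 : 1 ≤ Real.log n := by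
    rw [Real.le_log_iff_exp_le hn0]
    have h3 : (3 : ℝ) ≤ n := by exact_mod_cast hn
    linarith [Real.exp_one_lt_d9]
  set ρ := meshRatio d ε with hρ
  have hρ0 : 0 < ρ := by rw [hρ]; unfold meshRatio; positivity
  have hρ1 : ρ ≤ 1 := by
    have h1 : (1 : ℝ) ≤ 20 ^ d := one_le_pow₀ (by norm_num)
    rw [hρ]; unfold meshRatio
    rw [div_le_one (by positivity)]; linarith
  have hγ0 : 0 < discRatio d ε := by unfold discRatio; positivity
  have hγ1 : discRatio d ε ≤ 1 := by
    have h1 : (1 : ℝ) ≤ 2 ^ d := one_le_pow₀ (by norm_num)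
    unfold discRatio
    rw [div_le_one (by positivity), ← hρ]; linarith
  have hW : 0 < (r / √d) ^ d := by positivity
  have hlog := log_le_of_radiusBound_le hd (by omega) hε (by unfold radiusConst; positivity) h
  have hKd := radiusConst_pow_ge hd
  have hnW : 1 ≤ n * (r / √d) ^ d := by
    refine le_trans ?_ hlog
    have h1 : 1 ≤ (ε ^ 2)⁻¹ := by
      rw [one_le_inv₀ (by positivity)]; nlinarith
    have h2 : (1 : ℝ) ≤ radiusConst ^ d := by
      refine le_trans ?_ hKd
      have : (1 : ℝ) ≤ 24000 ^ d := one_le_pow₀ (by norm_num)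
      linarith
    exact one_le_mul_of_one_le_of_one_le (one_le_mul_of_one_le_of_one_le h2 h1) hlog1
  have hNceil : √d / (ρ * r) ≤ N := by rw [hN]; exact Nat.le_ceil _
  have hNlt : (N : ℝ) < √d / (ρ * r) + 1 := by rw [hN]; exact Nat.ceil_lt_add_one (by positivity)
  have hN0 : (0 : ℝ) < N := lt_of_lt_of_le (by positivity) hNceil
  have hmesh : √d / N ≤ ρ * r := by
    rw [div_le_iff₀ hN0, mul_comm, ← div_le_iff₀ (by positivity)]; exact hNceil
  refine ⟨by exact_mod_cast hN0, hmesh, ?_⟩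
  have hMge : 2 * r * N + 1 ≤ M := by
    have h1 : 2 * √d / ρ + 2 * √d + 1 ≤ M := by rw [hM]; exact Nat.le_ceil _
    have h2 : 2 * r * N ≤ 2 * r * (√d / (ρ * r) + 1) := by gcongr
    have h3 : 2 * r * (√d / (ρ * r) + 1) = 2 * √d / ρ + 2 * r := by field_simp
    linarith
  have h15 : (1 : ℝ) ≤ 15 ^ d := one_le_pow₀ (by norm_num)
  refine (measureReal_not_evenlySpread_le hd (by exact_mod_cast hN0) hr
    (hmesh.trans (mul_le_of_le_one_left hr.le hρ1)) hMge (by positivity) ?_).trans ?_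
  · rw [mul_pow]
    nlinarith [mul_le_mul_of_nonneg_right hγ1 hW.le, mul_le_mul_of_nonneg_right h15 hW.le]
  have hexp : Real.exp (-(n * (discRatio d ε * (r / √d) ^ d) ^ 2 / (4 * (15 * (r / √d)) ^ d))) ≤
      1 / (n : ℝ) ^ 2 := by
    -- Here `12800 = 64 * 200` and `24000 = 20² * 2² * 15`, from the mesh, the discrepancy and the
    -- ball volume.
    have e1 : n * (discRatio d ε * (r / √d) ^ d) ^ 2 / (4 * (15 * (r / √d)) ^ d) =
        ε ^ 2 / (4 * 12800 ^ 2 * 24000 ^ d) * (n * (r / √d) ^ d) := by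
      have e2 : (24000 : ℝ) ^ d = (20 ^ d) ^ 2 * (2 ^ d) ^ 2 * 15 ^ d := by
        rw [← pow_mul, ← pow_mul, mul_comm d 2, pow_mul, pow_mul, ← mul_pow, ← mul_pow]
        norm_num
      rw [e2, mul_pow 15]
      unfold discRatio meshRatio
      generalize (r / √d) ^ d = w at hW ⊢
      field_simp
      norm_num
    have e3 : 2 * Real.log n ≤ ε ^ 2 / (4 * 12800 ^ 2 * 24000 ^ d) * (n * (r / √d) ^ d) := by
      calc 2 * Real.log n = ε ^ 2 / (4 * 12800 ^ 2 * 24000 ^ d) *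
            (8 * 12800 ^ 2 * 24000 ^ d * (ε ^ 2)⁻¹ * Real.log n) := by
            field_simp; norm_num
        _ ≤ ε ^ 2 / (4 * 12800 ^ 2 * 24000 ^ d) *
            (radiusConst ^ d * (ε ^ 2)⁻¹ * Real.log n) := by gcongr
        _ ≤ _ := by gcongr
    rw [e1]
    calc _ ≤ Real.exp (-(2 * Real.log n)) := Real.exp_le_exp.2 (neg_le_neg e3)
      _ = 1 / (n : ℝ) ^ 2 := by
        rw [Real.exp_neg, one_div, two_mul, Real.exp_add, Real.exp_log hn0, sq]
  -- There are `O((√d / r) ^ d)` base cells, and `n * W ≥ 1` makes this `O(n)`. Against the tail `1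
  -- / n²` it leaves `O(1/n)`.
  have hNpow : ((N : ℝ) + 1) ^ d ≤ (1 / ρ + 2) ^ d * n := by
    have h1 : (N : ℝ) + 1 ≤ (1 / ρ + 2) * (√d / r) := by
      have h2 : √d / (ρ * r) = 1 / ρ * (√d / r) := by field_simp
      have h3 : 1 ≤ √d / r := (one_le_div hr).2 hr'
      rw [h2] at hNlt
      linarith
    refine (pow_le_pow_left₀ (by positivity) h1 d).trans ?_
    rw [mul_pow]
    refine mul_le_mul_of_nonneg_left ?_ (by positivity)
    have h2 : (√d / r) ^ d * (r / √d) ^ d = 1 := by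
      rw [← mul_pow]; field_simp; simp
    refine le_of_mul_le_mul_right ?_ hW
    rw [h2]; exact hnW
  calc _ ≤ (1 / ρ + 2) ^ d * n * 2 ^ ((2 * M + 1) ^ d) * (2 * (1 / (n : ℝ) ^ 2)) := by gcongr
    _ = _ := by field_simp

/-! ### Passage to the limit. -/

theorem tendsto_radiusBound {d : ℕ} (hd : 1 ≤ d) (C : ℝ) :
    Tendsto (fun n => radiusBound C d n) atTop (𝓝 0) := by
  have h1 : Tendsto (fun x : ℝ => Real.log x / x) atTop (𝓝 0) := by
    simpa using Real.tendsto_pow_log_div_mul_add_atTop 1 0 1 one_ne_zero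
  have hpos : (0 : ℝ) < 1 / d := by
    have : (0 : ℝ) < d := by exact_mod_cast hd
    positivity
  have h2 := ((h1.comp tendsto_natCast_atTop_atTop).rpow_const
    (p := (1 : ℝ) / d) (Or.inr hpos.le)).const_mul C
  rw [Real.zero_rpow hpos.ne', mul_zero] at h2
  exact h2

/-- Subadditivity on `S n ∪ (S n)ᶜ` suffices, so the events need not be measurable. -/
theorem tendsto_one_of_real_compl_le {Ω : ℕ → Type*} [∀ n, MeasurableSpace (Ω n)]
    (μ : ∀ n, Measure (Ω n)) [∀ n, IsProbabilityMeasure (μ n)] (S : ∀ n, Set (Ω n)) {c : ℝ}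
    (h : ∀ᶠ n : ℕ in atTop, (μ n).real (S n)ᶜ ≤ c / n) :
    Tendsto (fun n => μ n (S n)) atTop (𝓝 1) := by
  have h0 : Tendsto (fun n : ℕ => 1 - ENNReal.ofReal (c / n)) atTop (𝓝 1) := by
    have h1 : Tendsto (fun n : ℕ => ENNReal.ofReal (c / n)) atTop (𝓝 0) := by
      simpa [Function.comp_def] using (ENNReal.continuous_ofReal.tendsto 0).comp
        (tendsto_const_div_atTop_nhds_zero_nat c)
    simpa using ENNReal.Tendsto.sub (tendsto_const_nhds (x := (1 : ENNReal))) h1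
      (Or.inl ENNReal.one_ne_top)
  refine tendsto_of_tendsto_of_tendsto_of_le_of_le' h0 tendsto_const_nhds ?_
    (Eventually.of_forall fun n => prob_le_one)
  filter_upwards [h] with n hn
  rw [tsub_le_iff_right]
  calc (1 : ENNReal) = μ n (S n ∪ (S n)ᶜ) := by rw [Set.union_compl_self, measure_univ]
    _ ≤ μ n (S n) + μ n (S n)ᶜ := measure_union_le _ _
    _ ≤ μ n (S n) + ENNReal.ofReal (c / n) := by
      gcongr
      rw [← ofReal_measureReal]
      exact ENNReal.ofReal_le_ofReal hn

/-- Membership in the cube is kept in the event so that radii above `√d` can later be truncated. -/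
theorem tendsto_pointsLaw_isKConnected {d : ℕ} (hd : 1 ≤ d) {ε : ℝ} (hε : 0 < ε)
    (hε' : ε ≤ 1 / 2) {r : ℕ → ℝ}
    (h : ∀ᶠ n in atTop, radiusBound (radiusConst * ε ^ (-2 / (d : ℝ)) * √(d : ℝ)) d n ≤ r n ∧
      r n ≤ √d) :
    Tendsto (fun n => pointsLaw d n {X | (∀ i, X i ∈ unitCube d) ∧ ∀ H : SimpleGraph (Fin n),
      IsAlphaSubgraph (1 / 2 + ε) H (geomGraph X (r n)) →
        IsKConnected H ⌈connRatio d ε * r n ^ d * (n : ℝ)⌉₊}) atTop (𝓝 1) := by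
  set M := ⌈2 * √d / meshRatio d ε + 2 * √d + 1⌉₊ with hM
  refine tendsto_one_of_real_compl_le _ _
    (c := (1 / meshRatio d ε + 2) ^ d * 2 ^ ((2 * M + 1) ^ d) * 2) ?_
  filter_upwards [h, eventually_ge_atTop 3] with n hn hn3
  have hd0 : 0 < √(d : ℝ) := Real.sqrt_pos.2 (by exact_mod_cast hd)
  have hr : 0 < r n := by
    refine lt_of_lt_of_le ?_ hn.1
    have hlog : 0 < Real.log n := Real.log_pos (by exact_mod_cast (by omega : 1 < n))
    have hn0 : (0 : ℝ) < n := by positivity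
    unfold radiusBound radiusConst
    positivity
  obtain ⟨hN, hmesh, hle⟩ := measureReal_not_evenlySpread_le_div hd hn3 hε hε' hr hn.2 hn.1 rfl hM
  refine le_trans ?_ hle
  have hnull : (pointsLaw d n).real {X | ¬ ∀ i, X i ∈ unitCube d} = 0 := by
    rw [measureReal_def, show pointsLaw d n {X | ¬ ∀ i, X i ∈ unitCube d} = 0 from
      ae_iff.1 (ae_mem_unitCube d n), ENNReal.toReal_zero]
  have hsub : ∀ S T : Set (Fin n → EuclideanSpace ℝ (Fin d)),
      S ⊆ {X | ¬ ∀ i, X i ∈ unitCube d} ∪ T → (pointsLaw d n).real S ≤ (pointsLaw d n).real T :=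
    fun S T hST => (measureReal_mono hST (measure_ne_top _ _)).trans
      ((measureReal_union_le _ _).trans (by rw [hnull, zero_add]))
  refine hsub _ _ ?_
  intro X hX
  by_cases hc : ∀ i, X i ∈ unitCube d
  · refine Or.inr fun hs => hX ⟨hc, fun H hH => ?_⟩
    exact isKConnected_of_evenlySpread hd (by omega) hε hε' hr hn.2 hN hmesh hc hs hH
  · exact Or.inl hc

theorem IsKConnected.connected {V : Type*} [Fintype V] {G : SimpleGraph V} {k : ℕ}
    (h : IsKConnected G k) (hk : 0 < k) : G.Connected := by
  have h1 := h.2 ∅ (by simpa using hk)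
  rw [Finset.coe_empty, Set.compl_empty] at h1
  exact (SimpleGraph.induceUnivIso G).connected_iff.1 h1

theorem geomGraph_min_sqrt {d n : ℕ} {X : Fin n → EuclideanSpace ℝ (Fin d)}
    (hX : ∀ i, X i ∈ unitCube d) (r : ℝ) : geomGraph X (min r √d) = geomGraph X r := by
  ext i j
  simp only [geomGraph, le_min_iff]
  exact and_congr_right fun _ => and_iff_left (dist_le_sqrt_of_mem_unitCube (hX i) (hX j))

end RGG

theorem theorem3p1 :
    ∃ K : ℝ, 0 < K ∧
      ∀ ε : ℝ, 0 < ε → ε ≤ 1 / 2 → ∀ d : ℕ, 1 ≤ d →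
        ∃ c₁ C₁ : ℝ, 0 < c₁ ∧ 0 < C₁ ∧
          C₁ = K * ε ^ (-2 / (d : ℝ)) * Real.sqrt (d : ℝ) ∧
          (∀ r : ℕ → ℝ,
            (∀ᶠ n in atTop, RGG.radiusBound C₁ d n ≤ r n ∧ r n ≤ Real.sqrt (d : ℝ)) →
            RGG.AAS d r (fun n G => ∀ H : SimpleGraph (Fin n),
              RGG.IsAlphaSubgraph (1 / 2 + ε) H G →
                RGG.IsKConnected H ⌈c₁ * r n ^ d * (n : ℝ)⌉₊)) ∧
          (∀ r : ℕ → ℝ,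
            (∀ᶠ n in atTop, RGG.radiusBound C₁ d n ≤ r n) →
            RGG.AAS d r (fun n G => ∀ H : SimpleGraph (Fin n),
              RGG.IsAlphaSubgraph (1 / 2 + ε) H G → H.Connected)) := by
  refine ⟨RGG.radiusConst, by unfold RGG.radiusConst; positivity, fun ε hε hε' d hd => ?_⟩
  have hd0 : 0 < √(d : ℝ) := Real.sqrt_pos.2 (by exact_mod_cast hd)
  have hc : 0 < RGG.connRatio d ε := by
    unfold RGG.connRatio RGG.discRatio RGG.meshRatio; positivity
  refine ⟨RGG.connRatio d ε, RGG.radiusConst * ε ^ (-2 / (d : ℝ)) * √(d : ℝ), hc,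
    by unfold RGG.radiusConst; positivity, rfl, fun r h => ?_, fun r h => ?_⟩
  · refine tendsto_of_tendsto_of_tendsto_of_le_of_le
      (RGG.tendsto_pointsLaw_isKConnected hd hε hε' h) tendsto_const_nhds
      (fun n => measure_mono fun X hX => hX.2) (fun n => prob_le_one)
  -- With all points in the cube, radii beyond its diameter bound `√d` give the same graph, so `r`
  -- may be replaced by `min r √d`.
  · have hmin : ∀ᶠ n in atTop,
        RGG.radiusBound (RGG.radiusConst * ε ^ (-2 / (d : ℝ)) * √(d : ℝ)) d n ≤ min (r n) √d ∧
          min (r n) √d ≤ √d := by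
      filter_upwards [h, (RGG.tendsto_radiusBound hd _).eventually_le_const hd0] with n hn hn'
      exact ⟨le_min hn hn', min_le_right _ _⟩
    refine tendsto_of_tendsto_of_tendsto_of_le_of_le'
      (RGG.tendsto_pointsLaw_isKConnected hd hε hε' hmin) tendsto_const_nhds ?_
      (Eventually.of_forall fun n => prob_le_one)
    filter_upwards [hmin, eventually_ge_atTop 2] with n hn hn2
    refine measure_mono fun X hX H hH => ?_
    have hlog : 0 < Real.log n := Real.log_pos (by exact_mod_cast hn2)
    have hn0 : (0 : ℝ) < n := by positivity
    have hr : 0 < min (r n) √d := by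
      refine lt_of_lt_of_le ?_ hn.1
      unfold RGG.radiusBound RGG.radiusConst
      positivity
    refine (hX.2 H ?_).connected (Nat.ceil_pos.2 (by positivity))
    rwa [RGG.geomGraph_min_sqrt hX.1]
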